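/- Let $d\ge 0$, $G=\mathbb{Z}^d$ with the lattice distance $|i-j|=\sum_k|i_k-j_k|$, and $S^1=[0,2\pi)$ (angles mod $2\pi$) with Lebesgue measure $\lambda$. Let $\Phi=(\Phi_A)_{A\subset G,\ A\text{ finite}}$ be a potential of continuous functions $\Phi_A:(S^1)^G\to\mathbb{R}$, $\Phi_A$ depending only on the spins in $A$, which is translation-invariant, invariant under joint rotation of all spins, and absolutely summable, $\sum_{A\ni 0}\|\Phi_A\|_\infty<\infty$. Write $H_\Lambda=\sum_{A\cap\Lambda\ne\emptyset}\Phi_A$ for finite $\Lambda\subset G$. Let $\alpha_1>0$ and suppose that the interaction decays exponentially with exponent $\alpha_1$: $$\sum_{A\ni 0}(\sup\Phi_A-\inf\Phi_A)\sum_{j\in A\setminus\{0\}}e^{\alpha_1|j|}<\infty .$$ (This holds for every $\alpha_1$ if $\Phi$ has finite range, for instance for the nearest-neighbour rotator model $-\beta\sum_{i\sim j}\cos(\sigma_i-\sigma_j)$.) For $q\ge1$ let $T:S^1\to\mathbb{Z}_q=\{0,\dots,q-1\}$, $T(\varphi)=k$ iff $2\pi k/q\le\varphi<2\pi(k+1)/q$,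 be the discretization into $q$ equal arcs, applied sitewise to configurations. For $\sigma'\in(\mathbb{Z}_q)^G$ let $\gamma^{\sigma'}$ be the constrained specification $$\gamma^{\sigma'}_\Lambda(B\mid\eta)=\frac{\int 1_B(\sigma_\Lambda\eta_{\Lambda^c})\,1_{T(\sigma_\Lambda)=\sigma'_\Lambda}\,e^{-H_\Lambda(\sigma_\Lambda\eta_{\Lambda^c})}\,\lambda^{\otimes\Lambda}(d\sigma_\Lambda)}{\int 1_{T(\sigma_\Lambda)=\sigma'_\Lambda}\,e^{-H_\Lambda(\sigma_\Lambda\eta_{\Lambda^c})}\,\lambda^{\otimes\Lambda}(d\sigma_\Lambda)},\qquad \Lambda\subset G\text{ finite}.$$ Then there is $q_0\in\mathbb{N}$ (depending on $\Phi$ and $\alpha_1$) such that for all $q\ge q_0$ the following holds. For every $\sigma'\in(\mathbb{Z}_q)^G$ there is exactly one Gibbs probability measure $\mu_G[\sigma']$ on $(S^1)^G$ for $\gamma^{\sigma'}$, that is, exactly one probability measure $\mu$ with $\int\gamma^{\sigma'}_\Lambda(B\mid\eta)\,\mu(d\eta)=\mu(B)$ for all finite $\Lambda$ and all measurable $B$.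 Moreover, for $0\le\tau<2\pi$ let $M_\tau(\sigma',\cdot)$ be the Sample-Rotate-Project kernel, i.e. the law of $T(\sigma+\tau)$ when $\sigma$ has law $\mu_G[\sigma']$. Then $M_\tau$ is exponentially local from the past with exponent $\alpha_1$, uniformly in $\tau$: there is a constant $K>0$ such that for all $\tau\in[0,2\pi)$, all $i\in G$, all nonempty finite $\Lambda\subset G$, all $\eta\in(\mathbb{Z}_q)^G$ and all $\sigma',\tilde\sigma'\in(\mathbb{Z}_q)^G$ that agree off $i$, $$\bigl|M_\tau(\sigma',\eta_\Lambda)-M_\tau(\tilde\sigma',\eta_\Lambda)\bigr|\le K e^{-\alpha_1|i-\Lambda|},$$ where $\eta_\Lambda=\{\xi:\xi_j=\eta_j\ \forall j\in\Lambda\}$ and $|i-\Lambda|=\min_{j\in\Lambda}|i-j|$. -/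

import Mathlib

open MeasureTheory Set
open scoped ENNReal

namespace RotatorPCA

noncomputable section

/-- The lattice `ℤ^d`. -/
abbrev Lattice (d : ℕ) : Type := Fin d → ℤ

/-- The lattice (graph) distance `|i - j| = ∑ₖ |iₖ - jₖ|`. -/
def latticeDist {d : ℕ} (i j : Lattice d) : ℕ := ∑ k, (i k - j k).natAbs

/-- `|i - Λ| = min_{j ∈ Λ} |i - j|` for a nonempty finite `Λ`. -/
def distToSet {d : ℕ} (i : Lattice d) (Λ : Finset (Lattice d)) (hΛ : Λ.Nonempty) : ℕ :=
  Λ.inf' hΛ (latticeDist i)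

/-- The circle `S¹ = ℝ / 2πℤ`, whose `volume` is Lebesgue measure of total mass `2π`. -/
abbrev Sphere1 : Type := AddCircle (2 * Real.pi)

instance fact_two_pi_pos : Fact (0 < 2 * Real.pi) := ⟨Real.two_pi_pos⟩

/-- Continuous-spin configurations. -/
abbrev SpinConf (d : ℕ) : Type := Lattice d → Sphere1

/-- Discrete-spin configurations. -/
abbrev DiscConf (d q : ℕ) : Type := Lattice d → Fin q

/-- The representative in `[0, 2π)` of a point of the circle. -/
def angle (x : Sphere1) : ℝ := (AddCircle.equivIco (2 * Real.pi) 0 x : ℝ)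

theorem angle_mem (x : Sphere1) : 0 ≤ angle x ∧ angle x < 2 * Real.pi := by
  have h := (AddCircle.equivIco (2 * Real.pi) 0 x).2
  exact ⟨h.1, by simpa [angle] using h.2⟩

theorem floor_lt (q : ℕ) [NeZero q] (x : Sphere1) :
    ⌊(q : ℝ) * angle x / (2 * Real.pi)⌋₊ < q := by
  have hq : (0 : ℝ) < q := by exact_mod_cast Nat.pos_of_ne_zero (NeZero.ne q)
  have hx := angle_mem x
  have hp := Real.two_pi_pos
  rw [Nat.floor_lt (by have := hx.1; positivity), div_lt_iff₀ hp]
  exact mul_lt_mul_of_pos_left hx.2 hq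

/-- The coarse-graining into `q` equal arcs: `discretize q φ = k` iff
`2πk/q ≤ φ < 2π(k+1)/q`, for `φ ∈ [0, 2π)` and `k ∈ {0, …, q - 1}`. -/
def discretize (q : ℕ) [NeZero q] (x : Sphere1) : Fin q :=
  ⟨⌊(q : ℝ) * angle x / (2 * Real.pi)⌋₊, floor_lt q x⟩

theorem discretize_eq_iff (q : ℕ) [NeZero q] (x : Sphere1) (k : Fin q) :
    discretize q x = k ↔
      2 * Real.pi * (k : ℕ) / q ≤ angle x ∧ angle x < 2 * Real.pi * ((k : ℕ) + 1) / q := by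
  have hq : (0 : ℝ) < q := by exact_mod_cast Nat.pos_of_ne_zero (NeZero.ne q)
  have hx := angle_mem x
  have hp := Real.two_pi_pos
  rw [discretize, Fin.ext_iff, Nat.floor_eq_iff (by have := hx.1; positivity),
    le_div_iff₀ hp, div_lt_iff₀ hp, div_le_iff₀ hq, lt_div_iff₀ hq]
  constructor <;> rintro ⟨h1, h2⟩ <;> constructor <;> linarith

theorem measurable_angle : Measurable angle :=
  measurable_subtype_coe.comp (AddCircle.measurableEquivIco (2 * Real.pi) 0).measurable

theorem measurable_discretize (q : ℕ) [NeZero q] : Measurable (discretize q) := by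
  refine measurable_to_countable' fun k => ?_
  have : discretize q ⁻¹' {k} = angle ⁻¹'
      Set.Ico (2 * Real.pi * (k : ℕ) / q) (2 * Real.pi * ((k : ℕ) + 1) / q) := by
    ext x
    exact discretize_eq_iff q x k
  rw [this]
  exact measurable_angle measurableSet_Ico

/-- A family `(Φ_A)` of functions on continuous-spin configurations, indexed by the finite
subsets `A` of the lattice. -/
abbrev Potential (d : ℕ) : Type := Finset (Lattice d) → SpinConf d → ℝ

/-- `Φ` is a continuous, absolutely summable, translation-invariant and rotation-invariant
potential. -/
structure IsAdmissible {d : ℕ} (Φ : Potential d) : Prop where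
  /-- `Φ_A` depends only on the spins in `A`. -/
  local_dep : ∀ A (σ ω : SpinConf d), (∀ i ∈ A, σ i = ω i) → Φ A σ = Φ A ω
  continuous : ∀ A, Continuous (Φ A)
  translation_inv : ∀ A (k : Lattice d) (σ : SpinConf d),
    Φ (A.map (Equiv.addRight k).toEmbedding) σ = Φ A fun i => σ (i + k)
  rotation_inv : ∀ A (t : Sphere1) (σ : SpinConf d), Φ A (fun i => σ i + t) = Φ A σ
  /-- `∑_{A ∋ 0} ‖Φ_A‖_∞ < ∞`. -/
  abs_summable :
    ∑' A : {A : Finset (Lattice d) // (0 : Lattice d) ∈ A}, ⨆ σ, ‖Φ A.1 σ‖ₑ < ∞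

/-- The interaction decays exponentially with exponent `α`:
`∑_{A ∋ 0} δ(Φ_A) ∑_{j ∈ A, j ≠ 0} e^{α |j|} < ∞`, with `δ(Φ_A) = sup Φ_A - inf Φ_A`. -/
def DecaysExponentially {d : ℕ} (Φ : Potential d) (α : ℝ) : Prop :=
  ∑' A : {A : Finset (Lattice d) // (0 : Lattice d) ∈ A},
    (⨆ (σ : SpinConf d) (ω : SpinConf d), ‖Φ A.1 σ - Φ A.1 ω‖ₑ) *
      ∑ j ∈ A.1.erase 0, ENNReal.ofReal (Real.exp (α * latticeDist j 0)) < ∞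

open Classical in
/-- The Hamiltonian `H_Λ = ∑_{A ∩ Λ ≠ ∅} Φ_A`. -/
def hamiltonian {d : ℕ} (Φ : Potential d) (Λ : Finset (Lattice d)) (σ : SpinConf d) : ℝ :=
  ∑' A : Finset (Lattice d), if (A ∩ Λ).Nonempty then Φ A σ else 0

open Classical in
/-- The configuration `x_Λ η_{Λᶜ}`. -/
def glue {d : ℕ} (Λ : Finset (Lattice d)) (x : Λ → Sphere1) (η : SpinConf d) : SpinConf d :=
  fun i => if h : i ∈ Λ then x ⟨i, h⟩ else η i

/-- `∫ 1_B(x_Λ η_{Λᶜ}) 1_{T(x_Λ) = σ'_Λ} exp(-H_Λ(x_Λ η_{Λᶜ})) λ^{⊗Λ}(dx_Λ)`. -/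
def constrainedWeight {d q : ℕ} [NeZero q] (Φ : Potential d) (σ' : DiscConf d q)
    (Λ : Finset (Lattice d)) (η : SpinConf d) (B : Set (SpinConf d)) : ℝ≥0∞ :=
  ∫⁻ x in {x : Λ → Sphere1 | glue Λ x η ∈ B ∧ ∀ i : Λ, discretize q (x i) = σ' i},
    ENNReal.ofReal (Real.exp (-hamiltonian Φ Λ (glue Λ x η)))

/-- The constrained specification `γ^{σ'}_Λ(B | η)`: the Gibbs specification of `Φ`, with the
spins forced to lie in the arcs prescribed by `σ'`. -/
def constrainedSpec {d q : ℕ} [NeZero q] (Φ : Potential d) (σ' : DiscConf d q)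
    (Λ : Finset (Lattice d)) (η : SpinConf d) (B : Set (SpinConf d)) : ℝ≥0∞ :=
  constrainedWeight Φ σ' Λ η B / constrainedWeight Φ σ' Λ η univ

/-- `μ` is a Gibbs probability measure (DLR equations) for the specification `γ^{σ'}`. -/
def IsConstrainedGibbs {d q : ℕ} [NeZero q] (Φ : Potential d) (σ' : DiscConf d q)
    (μ : Measure (SpinConf d)) : Prop :=
  IsProbabilityMeasure μ ∧ ∀ (Λ : Finset (Lattice d)) (B : Set (SpinConf d)), MeasurableSet B →
    ∫⁻ η, constrainedSpec Φ σ' Λ η B ∂μ = μ B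

open Classical in
/-- The constrained Gibbs measure `μ_G[σ']` on the whole lattice: the Gibbs measure for
`γ^{σ'}` when there is exactly one, and the zero measure otherwise. -/
def constrainedGibbs {d q : ℕ} [NeZero q] (Φ : Potential d) (σ' : DiscConf d q) :
    Measure (SpinConf d) :=
  if h : ∃! μ : Measure (SpinConf d), IsConstrainedGibbs Φ σ' μ then h.choose else 0

/-- The Sample-Rotate-Project transition kernel: `M_τ(σ', ·)` is the law of `T(σ + τ)` when
`σ` has law `μ_G[σ']`. -/
def updateKernel {d q : ℕ} [NeZero q] (Φ : Potential d) (τ : ℝ) (σ' : DiscConf d q) :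
    Measure (DiscConf d q) :=
  (constrainedGibbs Φ σ').map fun σ i => discretize q (σ i + (τ : Sphere1))

/-- The map `σ ↦ T(σ + τ)` is measurable, so `updateKernel` is a genuine image measure. -/
theorem measurable_rotate_project (d q : ℕ) [NeZero q] (τ : ℝ) :
    Measurable fun (σ : SpinConf d) i => discretize q (σ i + (τ : Sphere1)) :=
  measurable_pi_lambda _ fun i =>
    (measurable_discretize q).comp ((measurable_pi_apply i).add_const _)

/-- The cylinder event `η_Λ`. -/
def cylinderSet {d q : ℕ} (Λ : Finset (Lattice d)) (η : DiscConf d q) : Set (DiscConf d q) :=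
  {ξ | ∀ j ∈ Λ, ξ j = η j}

/-- `M` is exponentially local from the past with exponent `α` and constant `K`:
`δ_i(M(·, η_Λ)) ≤ K e^{-α |i - Λ|}` for all sites `i`, all nonempty finite `Λ` and all `η`,
`δ_i` being the variation under a change of the initial spin at `i` only. -/
def IsExponentiallyLocalFromPast {d q : ℕ} (M : DiscConf d q → Measure (DiscConf d q))
    (α K : ℝ) : Prop :=
  ∀ (i : Lattice d) (Λ : Finset (Lattice d)) (hΛ : Λ.Nonempty) (η σ ω : DiscConf d q),
    (∀ j, j ≠ i → σ j = ω j) →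
      |(M σ).real (cylinderSet Λ η) - (M ω).real (cylinderSet Λ η)| ≤
        K * Real.exp (-α * distToSet i Λ hΛ)

end

end RotatorPCA

/-! The theorem is Dobrushin's uniqueness theorem with weights, in a regime where fine
discretization replaces high temperature. Confining each spin to an arc of length δ = 2π/q leaves
the interaction little room: the law of the spin at j depends on its surroundings only through
energy differences between two points of one arc, and these are controlled by the moduli of
continuity of the Φ_A at scale δ. This makes `interdependence` a matrix of Dobrushin coefficients
(`hamiltonian_singleton_le`, `isInterdependence_siteLaw`). Its row sums, even with the weight
e^{α|j-k|}, are at most `weightedModulus`, which tends to 0 as q → ∞ by dominated convergence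
(`tendsto_weightedModulus`). For q large they are at most 1/2.

An estimate `a` for (μ, ν) bounds μ(f) - ν(f) by ∑ a_k l_k when l bounds the oscillations of f. If
single-site laws of μ and ν differ by at most β_j at j, resampling site by site improves any
estimate until it reaches any b with C b + β ≤ b (`dobrushin_comparison`). For equal constraints β =
0 and b = 0, which is uniqueness. If the constraints differ only at i, then β = e_i, and the Neumann
series b = ∑ Cⁿ e_i has weighted sum ∑ b_k e^{α|k-i|} ≤ 2 (`exists_weighted_resolvent`), so its sum
over Λ is at most 2e^{-α|i-Λ|}. Existence follows from compactness and the Feller property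
(`exists_isConstrainedGibbs`). -/

namespace RotatorPCA

noncomputable section

/-! ### Dobrushin's comparison method for measures on a product space. -/

section Dobrushin

variable {ι S : Type*}

open Classical in
/-- The sum of the weights `l k` over the sites `k` at which `σ` and `ω` differ. -/
def diffSum (l : ι → ℝ≥0∞) (σ ω : ι → S) : ℝ≥0∞ := ∑' k, if σ k = ω k then 0 else l k

/-- `l` bounds the oscillations of `f`: changing the spins on a set of sites increases `f` by at
most the sum of `l` over these sites. -/
def OscBound (l : ι → ℝ≥0∞) (f : (ι → S) → ℝ≥0∞) : Prop := ∀ σ ω, f σ ≤ f ω + diffSum l σ ω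

theorem diffSum_le_tsum (l : ι → ℝ≥0∞) (σ ω : ι → S) : diffSum l σ ω ≤ ∑' k, l k := by
  refine ENNReal.tsum_le_tsum fun k => ?_
  split_ifs <;> simp

theorem diffSum_add (l m : ι → ℝ≥0∞) (σ ω : ι → S) :
    diffSum (fun k => l k + m k) σ ω = diffSum l σ ω + diffSum m σ ω := by
  rw [diffSum, diffSum, diffSum, ← ENNReal.tsum_add]
  refine tsum_congr fun k => ?_
  split_ifs <;> simp

theorem diffSum_const_mul (a : ℝ≥0∞) (l : ι → ℝ≥0∞) (σ ω : ι → S) :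
    diffSum (fun k => a * l k) σ ω = a * diffSum l σ ω := by
  rw [diffSum, diffSum, ← ENNReal.tsum_mul_left]
  refine tsum_congr fun k => ?_
  split_ifs <;> simp

section Estimate

variable [MeasurableSpace S]

/-- `a` is an estimate for the comparison of `μ` with `ν`. -/
def IsEstimate (μ ν : Measure (ι → S)) (a : ι → ℝ≥0∞) : Prop :=
  ∀ (f : (ι → S) → ℝ≥0∞) (l : ι → ℝ≥0∞), Measurable f → OscBound l f → ∑' k, l k ≠ ∞ →
    ∫⁻ σ, f σ ∂μ ≤ ∫⁻ σ, f σ ∂ν + ∑' k, a k * l k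

variable {μ ν : Measure (ι → S)}

theorem IsEstimate.mono {a a' : ι → ℝ≥0∞} (ha : IsEstimate μ ν a) (h : ∀ k, a k ≤ a' k) :
    IsEstimate μ ν a' := fun f l hf hl hs =>
  (ha f l hf hl hs).trans <| by
    gcongr with k
    exact h k

/-- The starting point of the iteration: a function varies by at most ∑ l_k in total. -/
theorem isEstimate_one [IsProbabilityMeasure μ] [IsProbabilityMeasure ν] :
    IsEstimate μ ν fun _ => 1 := by
  intro f l hf hl _
  have h (σ : ι → S) : f σ ≤ ∫⁻ ω, f ω ∂ν + ∑' k, l k := by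
    calc f σ = ∫⁻ _, f σ ∂ν := by simp
      _ ≤ ∫⁻ ω, (f ω + ∑' k, l k) ∂ν := by
        gcongr with ω
        exact (hl σ ω).trans (by gcongr; exact diffSum_le_tsum l σ ω)
      _ = _ := by rw [lintegral_add_right _ measurable_const]; simp
  calc ∫⁻ σ, f σ ∂μ ≤ ∫⁻ _, (∫⁻ ω, f ω ∂ν + ∑' k, l k) ∂μ := lintegral_mono h
    _ = _ := by simp

end Estimate

variable [DecidableEq ι]

theorem diffSum_update_same_conf (l : ι → ℝ≥0∞) (σ : ι → S) (j : ι) (x y : S) :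
    diffSum l (Function.update σ j x) (Function.update σ j y) ≤ l j := by
  rw [diffSum, tsum_eq_single j]
  · split_ifs <;> simp
  · intro k hk
    simp [hk]

theorem diffSum_update_same_spin (l : ι → ℝ≥0∞) (σ ω : ι → S) (j : ι) (x : S) :
    diffSum l (Function.update σ j x) (Function.update ω j x) ≤
      diffSum (fun k => if k = j then 0 else l k) σ ω := by
  refine ENNReal.tsum_le_tsum fun k => ?_
  by_cases hk : k = j
  · subst hk; simp
  · beta_reduce
    rw [Function.update_of_ne hk, Function.update_of_ne hk, if_neg hk]

theorem OscBound.comp_update {l : ι → ℝ≥0∞} {f : (ι → S) → ℝ≥0∞} (h : OscBound l f) (j : ι)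
    (η : ι → S) (x y : S) :
    f (Function.update η j x) ≤ f (Function.update η j y) + l j :=
  (h _ _).trans (by gcongr; exact diffSum_update_same_conf l η j x y)

variable [MeasurableSpace S]

/-- Resampling of the spin at `j` from the law `ρ j η`. -/
def siteAverage (ρ : ι → (ι → S) → Measure S) (j : ι) (f : (ι → S) → ℝ≥0∞) (η : ι → S) : ℝ≥0∞ :=
  ∫⁻ x, f (Function.update η j x) ∂ρ j η

/-- `C` is a matrix of interdependence coefficients for the single-site laws `ρ`. -/
def IsInterdependence (ρ : ι → (ι → S) → Measure S) (C : ι → ι → ℝ≥0∞) : Prop :=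
  ∀ (j : ι) (η ω : ι → S) (g : S → ℝ≥0∞) (r : ℝ≥0∞), Measurable g → (∀ x y, g x ≤ g y + r) →
    ∫⁻ x, g x ∂ρ j η ≤ ∫⁻ x, g x ∂ρ j ω + r * diffSum (C j) η ω

/-- Changing the surroundings acts twice: on the integrand away from j, where the old bounds remain,
and on the resampling law, where the integrand has oscillation at most l_j in the resampled spin.
The spin at j itself is integrated out, so its own term disappears. -/
theorem OscBound.siteAverage {ρ : ι → (ι → S) → Measure S} {C : ι → ι → ℝ≥0∞}
    [∀ j η, IsProbabilityMeasure (ρ j η)] (hC : IsInterdependence ρ C) {l : ι → ℝ≥0∞}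
    {f : (ι → S) → ℝ≥0∞} (hf : Measurable f) (h : OscBound l f) (j : ι) :
    OscBound (fun k => (if k = j then 0 else l k) + l j * C j k) (siteAverage ρ j f) := by
  intro η ω
  have hm (ζ : ι → S) : Measurable fun x => f (Function.update ζ j x) :=
    hf.comp (measurable_update ζ)
  calc ∫⁻ x, f (Function.update η j x) ∂ρ j η
      ≤ ∫⁻ x, f (Function.update η j x) ∂ρ j ω + l j * diffSum (C j) η ω :=
        hC j η ω _ _ (hm η) (h.comp_update j η)
    _ ≤ ∫⁻ x, (f (Function.update ω j x) + diffSum (fun k => if k = j then 0 else l k) η ω) ∂ρ j ω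
          + l j * diffSum (C j) η ω := by
        gcongr with x
        exact (h _ _).trans (by gcongr; exact diffSum_update_same_spin l η ω j x)
    _ = _ := by
        rw [lintegral_add_right _ measurable_const, lintegral_const, measure_univ, mul_one,
          diffSum_add, diffSum_const_mul, add_assoc]
        rfl

variable {μ ν : Measure (ι → S)}

/-- Both measures are invariant under their own resampling at j. Apply the old estimate to the
resampled f, then pay β_j l_j for exchanging `ρ` with `ρ'` under ν. -/
theorem IsEstimate.update {ρ ρ' : ι → (ι → S) → Measure S} {C : ι → ι → ℝ≥0∞} {β : ι → ℝ≥0∞}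
    [∀ j η, IsProbabilityMeasure (ρ j η)] (hC : IsInterdependence ρ C)
    (hCsum : ∀ j, ∑' k, C j k ≠ ∞)
    (hmeas : ∀ j f, Measurable f → Measurable (siteAverage ρ j f))
    (hρρ' : ∀ (j : ι) (η : ι → S) (g : S → ℝ≥0∞) (r : ℝ≥0∞), Measurable g →
      (∀ x y, g x ≤ g y + r) → ∫⁻ x, g x ∂ρ j η ≤ ∫⁻ x, g x ∂ρ' j η + β j * r)
    [IsProbabilityMeasure ν]
    (hμ : ∀ j f, Measurable f → ∫⁻ σ, siteAverage ρ j f σ ∂μ = ∫⁻ σ, f σ ∂μ)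
    (hν : ∀ j f, Measurable f → ∫⁻ σ, siteAverage ρ' j f σ ∂ν = ∫⁻ σ, f σ ∂ν)
    {a : ι → ℝ≥0∞} (ha : IsEstimate μ ν a) (j : ι) :
    IsEstimate μ ν (Function.update a j (∑' k, C j k * a k + β j)) := by
  intro f l hf hl hs
  have hlj : l j ≠ ∞ := ne_top_of_le_ne_top hs (ENNReal.le_tsum j)
  have hsum : ∑' k, ((if k = j then 0 else l k) + l j * C j k) ≠ ∞ := by
    rw [ENNReal.tsum_add, ENNReal.tsum_mul_left]
    refine ENNReal.add_ne_top.2 ⟨ne_top_of_le_ne_top hs ?_, ENNReal.mul_ne_top hlj (hCsum j)⟩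
    refine ENNReal.tsum_le_tsum fun k => ?_
    split_ifs <;> simp
  -- The term l_j C_jk moved onto the sites k is collected as the new coefficient of l_j.
  have key : ∑' k, Function.update a j (∑' k, C j k * a k + β j) k * l k =
      ∑' k, a k * ((if k = j then 0 else l k) + l j * C j k) + β j * l j := by
    have h1 : ∀ k, Function.update a j (∑' k, C j k * a k + β j) k * l k =
        a k * (if k = j then 0 else l k) +
          if k = j then (∑' k, C j k * a k + β j) * l j else 0 := by
      intro k
      by_cases hk : k = j
      · subst hk; simp
      · simp [hk]
    simp_rw [h1, mul_add, ENNReal.tsum_add, tsum_ite_eq, add_mul, ← ENNReal.tsum_mul_right]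
    rw [add_assoc]
    congr 3
    ext k
    ring
  calc ∫⁻ σ, f σ ∂μ = ∫⁻ σ, RotatorPCA.siteAverage ρ j f σ ∂μ := (hμ j f hf).symm
    _ ≤ ∫⁻ σ, RotatorPCA.siteAverage ρ j f σ ∂ν +
        ∑' k, a k * ((if k = j then 0 else l k) + l j * C j k) :=
      ha _ _ (hmeas j f hf) (hl.siteAverage hC hf j) hsum
    _ ≤ ∫⁻ σ, (RotatorPCA.siteAverage ρ' j f σ + β j * l j) ∂ν +
        ∑' k, a k * ((if k = j then 0 else l k) + l j * C j k) := by
      gcongr with σ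
      exact hρρ' j σ _ _ (hf.comp (measurable_update σ)) (hl.comp_update j σ)
    _ = _ := by
      rw [lintegral_add_right _ measurable_const, hν j f hf, key]
      simp only [lintegral_const, measure_univ, mul_one]
      rw [add_assoc, add_comm (β j * l j)]

/-- Since C b + β ≤ b and the rows of C sum to at most c, one update turns the excess s at a site
into c s. All sites are updated along growing finite sets. -/
theorem IsEstimate.contract {ρ ρ' : ι → (ι → S) → Measure S} {C : ι → ι → ℝ≥0∞}
    {β : ι → ℝ≥0∞} [∀ j η, IsProbabilityMeasure (ρ j η)] (hC : IsInterdependence ρ C)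
    {c : ℝ≥0∞} (hc : c < 1) (hCsum : ∀ j, ∑' k, C j k ≤ c)
    (hmeas : ∀ j f, Measurable f → Measurable (siteAverage ρ j f))
    (hρρ' : ∀ (j : ι) (η : ι → S) (g : S → ℝ≥0∞) (r : ℝ≥0∞), Measurable g →
      (∀ x y, g x ≤ g y + r) → ∫⁻ x, g x ∂ρ j η ≤ ∫⁻ x, g x ∂ρ' j η + β j * r)
    [IsProbabilityMeasure ν]
    (hμ : ∀ j f, Measurable f → ∫⁻ σ, siteAverage ρ j f σ ∂μ = ∫⁻ σ, f σ ∂μ)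
    (hν : ∀ j f, Measurable f → ∫⁻ σ, siteAverage ρ' j f σ ∂ν = ∫⁻ σ, f σ ∂ν)
    {b : ι → ℝ≥0∞} (hb : ∀ j, ∑' k, C j k * b k + β j ≤ b j) {s : ℝ≥0∞} (hs : s ≠ ∞)
    (h : IsEstimate μ ν fun k => b k + s) : IsEstimate μ ν fun k => b k + c * s := by
  have hcs : c * s ≤ s := mul_le_of_le_one_left' hc.le
  have hF (F : Finset ι) : IsEstimate μ ν fun k => if k ∈ F then b k + c * s else b k + s := by
    induction F using Finset.induction_on with
    | empty => simpa using h
    | insert j F hj ih =>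
      refine (ih.update hC (fun j => ne_top_of_le_ne_top hc.ne_top (hCsum j)) hmeas hρρ' hμ hν
        j).mono fun k => ?_
      by_cases hk : k = j
      · subst hk
        simp only [Function.update_self, Finset.mem_insert, true_or, if_true]
        calc ∑' i, C k i * (if i ∈ F then b i + c * s else b i + s) + β k
            -- The gain already made on F is discarded, so the order of the updates is irrelevant.
            ≤ ∑' i, C k i * (b i + s) + β k := by
              gcongr with i
              split_ifs
              · gcongr
              · rfl
          _ = (∑' i, C k i * b i + β k) + (∑' i, C k i) * s := by
              simp_rw [mul_add, ENNReal.tsum_add, ENNReal.tsum_mul_right]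
              ring
          _ ≤ b k + c * s := by
              gcongr
              · exact hb k
              · exact hCsum k
      · simp [hk]
  intro f l hf hl hsum
  -- Sites outside F still carry the excess s; their contribution is at most s times a tail of the
  -- convergent series ∑ l_k.
  have hlim := ENNReal.tendsto_tsum_compl_atTop_zero hsum
  have hlim2 := (ENNReal.Tendsto.const_mul hlim (Or.inr hs)).const_add
    (∫⁻ σ, f σ ∂ν + ∑' k, (b k + c * s) * l k)
  rw [mul_zero, add_zero] at hlim2
  refine ge_of_tendsto' hlim2 fun F => (hF F f l hf hl hsum).trans ?_
  rw [add_assoc]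
  gcongr
  have : ∑' k : {k // k ∉ F}, l k = ∑' k, if k ∈ F then 0 else l k := by
    refine (tsum_subtype {k | k ∉ F} l).trans ?_
    exact tsum_congr fun k => by by_cases hk : k ∈ F <;> simp [hk]
  rw [this, ← ENNReal.tsum_mul_left, ← ENNReal.tsum_add]
  refine ENNReal.tsum_le_tsum fun k => ?_
  by_cases hk : k ∈ F
  · simp [hk]
  · simp only [hk, if_false]
    rw [← add_mul, add_assoc]
    gcongr
    exact le_add_self

/-- **Dobrushin's comparison theorem.** -/
theorem dobrushin_comparison {ρ ρ' : ι → (ι → S) → Measure S} {C : ι → ι → ℝ≥0∞}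
    {β : ι → ℝ≥0∞} [∀ j η, IsProbabilityMeasure (ρ j η)] (hC : IsInterdependence ρ C)
    {c : ℝ≥0∞} (hc : c < 1) (hCsum : ∀ j, ∑' k, C j k ≤ c)
    (hmeas : ∀ j f, Measurable f → Measurable (siteAverage ρ j f))
    (hρρ' : ∀ (j : ι) (η : ι → S) (g : S → ℝ≥0∞) (r : ℝ≥0∞), Measurable g →
      (∀ x y, g x ≤ g y + r) → ∫⁻ x, g x ∂ρ j η ≤ ∫⁻ x, g x ∂ρ' j η + β j * r)
    [IsProbabilityMeasure μ] [IsProbabilityMeasure ν]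
    (hμ : ∀ j f, Measurable f → ∫⁻ σ, siteAverage ρ j f σ ∂μ = ∫⁻ σ, f σ ∂μ)
    (hν : ∀ j f, Measurable f → ∫⁻ σ, siteAverage ρ' j f σ ∂ν = ∫⁻ σ, f σ ∂ν)
    {b : ι → ℝ≥0∞} (hb : ∀ j, ∑' k, C j k * b k + β j ≤ b j) : IsEstimate μ ν b := by
  have hn (n : ℕ) : IsEstimate μ ν fun k => b k + c ^ n := by
    induction n with
    | zero => exact isEstimate_one.mono fun k => by simp
    | succ n ih =>
      simpa only [pow_succ'] using
        ih.contract hC hc hCsum hmeas hρρ' hμ hν hb (ENNReal.pow_ne_top hc.ne_top)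
  intro f l hf hl hsum
  have hlim := (ENNReal.Tendsto.mul_const (ENNReal.tendsto_pow_atTop_nhds_zero_of_lt_one hc)
    (Or.inr hsum)).const_add (∫⁻ σ, f σ ∂ν + ∑' k, b k * l k)
  rw [zero_mul, add_zero] at hlim
  refine ge_of_tendsto' hlim fun n => (hn n f l hf hl hsum).trans_eq ?_
  simp_rw [add_mul, ENNReal.tsum_add, ENNReal.tsum_mul_left]
  rw [add_assoc]

/-- If the columns of `C`, weighted with the submultiplicative `W`, have sums at most `c`, then
`b = C b + e_i` has a solution whose weighted sum is at most `1 / (1 - c)`. -/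
theorem exists_weighted_resolvent {C W : ι → ι → ℝ≥0∞} {c : ℝ≥0∞}
    (hW : ∀ k j i, W k i ≤ W k j * W j i) (hC : ∀ j, ∑' k, C k j * W k j ≤ c) (i : ι)
    (hWi : W i i = 1) :
    ∃ b : ι → ℝ≥0∞, (∀ j, ∑' k, C j k * b k + (if j = i then 1 else 0) ≤ b j) ∧
      ∑' k, b k * W k i ≤ (1 - c)⁻¹ := by
  -- `v n` is Cⁿ e_i. Its weighted sum is at most cⁿ by submultiplicativity of W, and b is the sum
  -- of the `v n`.
  let T : (ι → ℝ≥0∞) → ι → ℝ≥0∞ := fun v j => ∑' k, C j k * v k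
  let v : ℕ → ι → ℝ≥0∞ := fun n => T^[n] fun j => if j = i then 1 else 0
  have hv (n : ℕ) (j : ι) : v (n + 1) j = ∑' k, C j k * v n k := by
    simp only [v, Function.iterate_succ', Function.comp]
    rfl
  have hv0 (j : ι) : v 0 j = if j = i then 1 else 0 := rfl
  have hsum (n : ℕ) : ∑' k, v n k * W k i ≤ c ^ n := by
    induction n with
    | zero =>
      rw [tsum_eq_single i fun k hk => by simp [hv0, hk]]
      simp [hv0, hWi]
    | succ n ih =>
      calc ∑' k, v (n + 1) k * W k i
          = ∑' k, ∑' j, C k j * v n j * W k i := by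
            simp_rw [hv, ENNReal.tsum_mul_right]
        _ ≤ ∑' k, ∑' j, v n j * W j i * (C k j * W k j) := by
            refine ENNReal.tsum_le_tsum fun k => ENNReal.tsum_le_tsum fun j => ?_
            calc C k j * v n j * W k i ≤ C k j * v n j * (W k j * W j i) := by
                  gcongr
                  exact hW k j i
              _ = _ := by ring
        _ = ∑' j, v n j * W j i * ∑' k, C k j * W k j := by
            rw [ENNReal.tsum_comm]
            simp_rw [ENNReal.tsum_mul_left]
        _ ≤ ∑' j, v n j * W j i * c := by
            gcongr with j
            exact hC j
        _ ≤ c ^ (n + 1) := by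
            rw [ENNReal.tsum_mul_right, pow_succ]
            gcongr
  refine ⟨fun j => ∑' n, v n j, fun j => ?_, ?_⟩
  · beta_reduce
    rw [tsum_eq_zero_add' (f := fun n => v n j) ENNReal.summable, add_comm, hv0]
    gcongr
    simp_rw [hv, ← ENNReal.tsum_mul_left]
    rw [ENNReal.tsum_comm]
  · simp_rw [← ENNReal.tsum_mul_right]
    rw [ENNReal.tsum_comm, ← ENNReal.tsum_geometric]
    exact ENNReal.tsum_le_tsum hsum

end Dobrushin

/-! ### Potentials: moduli of continuity, summability and energy differences. -/

section Potential

variable {d : ℕ} {Φ : Potential d}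

/-- The translate `A + k`. -/
def translate (k : Lattice d) (A : Finset (Lattice d)) : Finset (Lattice d) :=
  A.map (Equiv.addRight k).toEmbedding

theorem mem_translate {k i : Lattice d} {A : Finset (Lattice d)} :
    i ∈ translate k A ↔ i - k ∈ A := by
  simp only [translate, Finset.mem_map_equiv, Equiv.addRight_symm, Equiv.coe_addRight,
    sub_eq_add_neg]

theorem tsum_ite_mem_eq (F : Finset (Lattice d) → ℝ≥0∞) (j : Lattice d) :
    ∑' A, (if j ∈ A then F A else 0) =
      ∑' A : {A : Finset (Lattice d) // (0 : Lattice d) ∈ A}, F (translate j A) := by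
  have h := tsum_subtype {A : Finset (Lattice d) | (0 : Lattice d) ∈ A} fun A => F (translate j A)
  refine Eq.trans ?_ h.symm
  rw [← (Equiv.addRight j).finsetCongr.tsum_eq]
  refine tsum_congr fun A => ?_
  have : j ∈ (Equiv.addRight j).finsetCongr A ↔ (0 : Lattice d) ∈ A := by
    simp
  simp only [this, Set.indicator, Set.mem_ofPred_eq]
  rfl

/-- The modulus of continuity of `Φ_A` for the uniform distance of configurations. -/
def modulus (Φ : Potential d) (δ : ℝ) (A : Finset (Lattice d)) : ℝ≥0∞ :=
  ⨆ (σ : SpinConf d) (ω : SpinConf d) (_ : ∀ i, dist (σ i) (ω i) ≤ δ), ‖Φ A σ - Φ A ω‖ₑ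

theorem le_modulus {δ : ℝ} (A : Finset (Lattice d)) {σ ω : SpinConf d}
    (h : ∀ i, dist (σ i) (ω i) ≤ δ) : ‖Φ A σ - Φ A ω‖ₑ ≤ modulus Φ δ A :=
  le_iSup_of_le σ <| le_iSup_of_le ω <| le_iSup_of_le h le_rfl

theorem modulus_le (δ : ℝ) (A : Finset (Lattice d)) :
    modulus Φ δ A ≤ ⨆ (σ : SpinConf d) (ω : SpinConf d), ‖Φ A σ - Φ A ω‖ₑ :=
  iSup_mono fun _ => iSup_mono fun _ => iSup_le fun _ => le_rfl

theorem modulus_translate_le (hΦ : IsAdmissible Φ) (δ : ℝ) (k : Lattice d)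
    (A : Finset (Lattice d)) : modulus Φ δ (translate k A) ≤ modulus Φ δ A := by
  refine iSup_le fun σ => iSup_le fun ω => iSup_le fun h => ?_
  rw [translate, hΦ.translation_inv, hΦ.translation_inv]
  exact le_modulus A fun i => h (i + k)

theorem latticeDist_comm (i j : Lattice d) : latticeDist i j = latticeDist j i :=
  Finset.sum_congr rfl fun k _ => by omega

theorem latticeDist_triangle (i j k : Lattice d) :
    latticeDist i k ≤ latticeDist i j + latticeDist j k := by
  rw [latticeDist, latticeDist, latticeDist, ← Finset.sum_add_distrib]
  exact Finset.sum_le_sum fun l _ => by omega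

theorem latticeDist_self (i : Lattice d) : latticeDist i i = 0 := by simp [latticeDist]

theorem latticeDist_sub (i j : Lattice d) : latticeDist (i - j) 0 = latticeDist i j := by
  simp [latticeDist]

/-- The weight `e^{α |i - j|}`. -/
def expWeight (α : ℝ) (i j : Lattice d) : ℝ≥0∞ :=
  ENNReal.ofReal (Real.exp (α * latticeDist i j))

theorem expWeight_self (α : ℝ) (i : Lattice d) : expWeight α i i = 1 := by
  simp [expWeight, latticeDist_self]

theorem expWeight_le_mul {α : ℝ} (hα : 0 ≤ α) (i j k : Lattice d) :
    expWeight α i k ≤ expWeight α i j * expWeight α j k := by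
  rw [expWeight, expWeight, expWeight, ← ENNReal.ofReal_mul (Real.exp_pos _).le, ← Real.exp_add,
    ← mul_add]
  have := latticeDist_triangle i j k
  gcongr
  exact_mod_cast this

theorem one_le_expWeight {α : ℝ} (hα : 0 ≤ α) (i j : Lattice d) : 1 ≤ expWeight α i j := by
  rw [expWeight, ENNReal.one_le_ofReal, Real.one_le_exp_iff]
  positivity

/-- The interdependence coefficients of the specification constrained to arcs of length `δ`. -/
def interdependence (Φ : Potential d) (δ : ℝ) (j k : Lattice d) : ℝ≥0∞ :=
  if k = j then 0 else 4 * ∑' A, if j ∈ A then (if k ∈ A then modulus Φ δ A else 0) else 0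

/-- Converts the weighted row bound into the column bound that `exists_weighted_resolvent` needs. -/
theorem interdependence_comm (δ : ℝ) (j k : Lattice d) :
    interdependence Φ δ j k = interdependence Φ δ k j := by
  rw [interdependence, interdependence]
  split_ifs with h1 h2 h2
  · rfl
  · exact absurd h1.symm h2
  · exact absurd h2.symm h1
  · congr 1
    refine tsum_congr fun A => ?_
    split_ifs <;> rfl

/-- The sum of the interdependence coefficients at a site, weighted with `e^{α |j - k|}`, is at
most this quantity. -/
def weightedModulus (Φ : Potential d) (α δ : ℝ) : ℝ≥0∞ :=
  4 * ∑' A : {A : Finset (Lattice d) // (0 : Lattice d) ∈ A},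
    modulus Φ δ A.1 * ∑ k ∈ A.1.erase 0, expWeight α k 0

theorem tsum_interdependence_mul_le (hΦ : IsAdmissible Φ) (α δ : ℝ) (j : Lattice d) :
    ∑' k, interdependence Φ δ j k * expWeight α k j ≤ weightedModulus Φ α δ := by
  have h1 (k : Lattice d) : interdependence Φ δ j k * expWeight α k j =
      4 * ∑' A, if j ∈ A then (if k ∈ A.erase j then modulus Φ δ A * expWeight α k j else 0)
        else 0 := by
    by_cases hk : k = j
    · simp [interdependence, hk]
    · simp only [interdependence, hk, if_false, mul_assoc, ← ENNReal.tsum_mul_right, ite_mul,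
        zero_mul, Finset.mem_erase, ne_eq, not_false_eq_true, true_and]
  have h2 (A : Finset (Lattice d)) :
      ∑' k, (if j ∈ A then (if k ∈ A.erase j then modulus Φ δ A * expWeight α k j else 0)
        else 0) = if j ∈ A then modulus Φ δ A * ∑ k ∈ A.erase j, expWeight α k j else 0 := by
    split_ifs
    · rw [tsum_eq_sum (s := A.erase j) fun k hk => if_neg hk, Finset.mul_sum]
      exact Finset.sum_congr rfl fun k hk => if_pos hk
    · simp
  simp_rw [h1, ENNReal.tsum_mul_left]
  -- With the sum over A outside, each A ∋ j is moved to a set containing 0 by translation.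
  rw [ENNReal.tsum_comm]
  simp_rw [h2]
  rw [tsum_ite_mem_eq, weightedModulus]
  refine mul_le_mul_right (ENNReal.tsum_le_tsum fun A => ?_) _
  refine mul_le_mul' (modulus_translate_le hΦ δ j A) (le_of_eq ?_)
  refine Finset.sum_bij (fun k _ => k - j) ?_ ?_ ?_ ?_
  · intro k hk
    rw [Finset.mem_erase, mem_translate] at hk
    exact Finset.mem_erase.2 ⟨sub_ne_zero.2 hk.1, hk.2⟩
  · intro a _ b _ h
    simpa using h
  · intro k hk
    rw [Finset.mem_erase] at hk
    exact ⟨k + j, by simp [mem_translate, hk.1, hk.2], by simp⟩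
  · intro k _
    simp only [expWeight, latticeDist_sub]

theorem tsum_interdependence_le (hΦ : IsAdmissible Φ) {α : ℝ} (hα : 0 ≤ α) (δ : ℝ)
    (j : Lattice d) : ∑' k, interdependence Φ δ j k ≤ weightedModulus Φ α δ :=
  le_trans (ENNReal.tsum_le_tsum fun k => le_mul_of_one_le_right' (one_le_expWeight hα k j))
    (tsum_interdependence_mul_le hΦ α δ j)

/-- Φ_A is uniformly continuous by compactness, and uniform closeness at all sites is finer than the
product uniformity. -/
theorem tendsto_modulus (hΦ : IsAdmissible Φ) (A : Finset (Lattice d)) {δ : ℕ → ℝ}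
    (hδ : Filter.Tendsto δ Filter.atTop (nhds 0)) :
    Filter.Tendsto (fun n => modulus Φ (δ n) A) Filter.atTop (nhds 0) := by
  have huc := CompactSpace.uniformContinuous_of_continuous (hΦ.continuous A)
  set D : SpinConf d × SpinConf d → ℝ≥0∞ := fun p => ⨆ i, edist (p.1 i) (p.2 i)
  have hle : Filter.comap D (nhds 0) ≤ uniformity (SpinConf d) := by
    rw [Pi.uniformity]
    refine le_iInf fun i s hs => ?_
    obtain ⟨t, ht, hts⟩ := hs
    obtain ⟨ε, hε, h⟩ := mem_uniformity_edist.1 ht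
    exact ⟨Iio ε, Iio_mem_nhds hε, fun p hp =>
      hts (h ((le_iSup (fun i => edist (p.1 i) (p.2 i)) i).trans_lt hp))⟩
  refine ENNReal.tendsto_nhds_zero.2 fun ε hε => ?_
  obtain ⟨t, ht, hts⟩ := hle (huc (edist_mem_uniformity hε))
  obtain ⟨r, hr, hrt⟩ := ENNReal.nhds_zero_basis.mem_iff.1 ht
  have hδ' : Filter.Tendsto (fun n => ENNReal.ofReal (δ n)) Filter.atTop (nhds 0) := by
    simpa using ENNReal.tendsto_ofReal hδ
  filter_upwards [hδ'.eventually_lt_const hr] with n hn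
  refine iSup_le fun σ => iSup_le fun ω => iSup_le fun h => ?_
  rw [← edist_eq_enorm_sub]
  have hD : D (σ, ω) < r := lt_of_le_of_lt (iSup_le fun i => by
    rw [edist_dist]
    exact ENNReal.ofReal_le_ofReal (h i)) hn
  have : edist (Φ A σ) (Φ A ω) < ε := hts (show (σ, ω) ∈ D ⁻¹' t from hrt hD)
  exact this.le

theorem tendsto_weightedModulus (hΦ : IsAdmissible Φ) {α : ℝ} (h : DecaysExponentially Φ α)
    {δ : ℕ → ℝ} (hδ : Filter.Tendsto δ Filter.atTop (nhds 0)) :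
    Filter.Tendsto (fun n => weightedModulus Φ α (δ n)) Filter.atTop (nhds 0) := by
  have hW (A : {A : Finset (Lattice d) // (0 : Lattice d) ∈ A}) :
      ∑ k ∈ A.1.erase 0, expWeight α k 0 ≠ ∞ :=
    (ENNReal.sum_lt_top.2 fun k _ => ENNReal.ofReal_lt_top).ne
  have key : Filter.Tendsto (fun n => ∑' A : {A : Finset (Lattice d) // (0 : Lattice d) ∈ A},
      modulus Φ (δ n) A.1 * ∑ k ∈ A.1.erase 0, expWeight α k 0) Filter.atTop (nhds 0) := by
    -- The series is an integral against counting measure, dominated by the sum in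
    -- `DecaysExponentially`.
    let _ : MeasurableSpace {A : Finset (Lattice d) // (0 : Lattice d) ∈ A} := ⊤
    have := tendsto_lintegral_of_dominated_convergence (μ := Measure.count)
      (F := fun n (A : {A : Finset (Lattice d) // (0 : Lattice d) ∈ A}) =>
        modulus Φ (δ n) A.1 * ∑ k ∈ A.1.erase 0, expWeight α k 0) (f := fun _ => 0)
      (fun A => (⨆ (σ : SpinConf d) (ω : SpinConf d), ‖Φ A.1 σ - Φ A.1 ω‖ₑ) *
        ∑ k ∈ A.1.erase 0, expWeight α k 0) (fun n => measurable_from_top)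
      (fun n => Filter.Eventually.of_forall fun A => mul_le_mul_left (modulus_le _ _) _)
      (by rw [lintegral_count]; exact h.ne)
      (Filter.Eventually.of_forall fun A => by
        simpa using ENNReal.Tendsto.mul_const (tendsto_modulus hΦ A.1 hδ) (Or.inr (hW A)))
    simpa [lintegral_count] using this
  simpa [weightedModulus] using ENNReal.Tendsto.const_mul key (Or.inr (by norm_num : (4 : ℝ≥0∞) ≠ ∞))

theorem tsum_ite_mem_iSup_ne_top (hΦ : IsAdmissible Φ) (j : Lattice d) :
    ∑' A, (if j ∈ A then ⨆ σ, ‖Φ A σ‖ₑ else 0) ≠ ∞ := by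
  rw [tsum_ite_mem_eq]
  refine ne_top_of_le_ne_top hΦ.abs_summable.ne (ENNReal.tsum_le_tsum fun A => ?_)
  refine iSup_le fun σ => ?_
  rw [translate, hΦ.translation_inv]
  exact le_iSup (fun σ => ‖Φ A.1 σ‖ₑ) _

-- A set meeting Λ contains some j ∈ Λ, so finitely many translates of the sum over A ∋ 0 suffice.
-- With suprema inside the sum, this is the Weierstrass criterion for the continuity of H_Λ.
open Classical in
theorem tsum_iSup_enorm_ne_top (hΦ : IsAdmissible Φ) (Λ : Finset (Lattice d)) :
    ∑' A, (⨆ σ, ‖if (A ∩ Λ).Nonempty then Φ A σ else 0‖ₑ) ≠ ∞ := by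
  have h : ∑ j ∈ Λ, ∑' A, (if j ∈ A then ⨆ σ, ‖Φ A σ‖ₑ else 0) ≠ ∞ :=
    ENNReal.sum_ne_top.2 fun j _ => tsum_ite_mem_iSup_ne_top hΦ j
  refine ne_top_of_le_ne_top h ?_
  rw [← Summable.tsum_finsetSum fun _ _ => ENNReal.summable]
  refine ENNReal.tsum_le_tsum fun A => iSup_le fun σ => ?_
  split_ifs with hA
  · obtain ⟨j, hj⟩ := hA
    rw [Finset.mem_inter] at hj
    refine le_trans ?_ (Finset.single_le_sum (fun _ _ => zero_le) hj.2)
    rw [if_pos hj.1]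
    exact le_iSup (fun σ => ‖Φ A σ‖ₑ) σ
  · simp

theorem summable_and_continuous_of_tsum_iSup {ι X : Type*} [TopologicalSpace X] {F : ι → X → ℝ}
    (hF : ∀ A, Continuous (F A)) (h : ∑' A, (⨆ x, ‖F A x‖ₑ) ≠ ∞) :
    (∀ x, Summable fun A => F A x) ∧ Continuous fun x => ∑' A, F A x := by
  have hA (A : ι) : (⨆ x, ‖F A x‖ₑ) ≠ ∞ := ne_top_of_le_ne_top h (ENNReal.le_tsum A)
  have hu : Summable fun A => (⨆ x, ‖F A x‖ₑ).toReal := ENNReal.summable_toReal h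
  have hb (A : ι) (x : X) : ‖F A x‖ ≤ (⨆ x, ‖F A x‖ₑ).toReal := by
    rw [← toReal_enorm]
    exact ENNReal.toReal_mono (hA A) (le_iSup (fun x => ‖F A x‖ₑ) x)
  exact ⟨fun x => Summable.of_norm_bounded hu fun A => hb A x, continuous_tsum hF hu hb⟩

open Classical in
theorem continuous_term (hΦ : IsAdmissible Φ) (Λ A : Finset (Lattice d)) :
    Continuous fun σ => if (A ∩ Λ).Nonempty then Φ A σ else 0 := by
  split_ifs
  · exact hΦ.continuous A
  · exact continuous_const

open Classical in
theorem summable_hamiltonian (hΦ : IsAdmissible Φ) (Λ : Finset (Lattice d)) (σ : SpinConf d) :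
    Summable fun A => if (A ∩ Λ).Nonempty then Φ A σ else 0 :=
  (summable_and_continuous_of_tsum_iSup (continuous_term hΦ Λ) (tsum_iSup_enorm_ne_top hΦ Λ)).1 σ

theorem continuous_hamiltonian (hΦ : IsAdmissible Φ) (Λ : Finset (Lattice d)) :
    Continuous (hamiltonian Φ Λ) :=
  (summable_and_continuous_of_tsum_iSup (continuous_term hΦ Λ) (tsum_iSup_enorm_ne_top hΦ Λ)).2

-- Only sets meeting Δ but not Λ contribute to H_Δ - H_Λ, and their terms do not see the spins in Λ.
open Classical in
theorem hamiltonian_sub_congr (hΦ : IsAdmissible Φ) {Λ Δ : Finset (Lattice d)} (h : Λ ⊆ Δ)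
    {σ ω : SpinConf d} (hσω : ∀ i ∉ Λ, σ i = ω i) :
    hamiltonian Φ Δ σ - hamiltonian Φ Λ σ = hamiltonian Φ Δ ω - hamiltonian Φ Λ ω := by
  rw [hamiltonian, hamiltonian, hamiltonian, hamiltonian,
    ← (summable_hamiltonian hΦ Δ σ).tsum_sub (summable_hamiltonian hΦ Λ σ),
    ← (summable_hamiltonian hΦ Δ ω).tsum_sub (summable_hamiltonian hΦ Λ ω)]
  refine tsum_congr fun A => ?_
  by_cases hA : (A ∩ Λ).Nonempty
  · have hA' : (A ∩ Δ).Nonempty := hA.mono (Finset.inter_subset_inter_left h)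
    simp [hA, hA']
  · have : Φ A σ = Φ A ω := hΦ.local_dep A σ ω fun i hi => hσω i fun hi' =>
      hA ⟨i, Finset.mem_inter.2 ⟨hi, hi'⟩⟩
    simp [hA, this]

/-- The change of the single-site energy difference between two close spins `x`, `y` at `j` when
the surroundings are changed from `η` to `ω`. -/
theorem hamiltonian_singleton_le (hΦ : IsAdmissible Φ) {δ : ℝ} (hδ : 0 ≤ δ) (j : Lattice d)
    (η ω : SpinConf d) {x y : Sphere1} (hxy : dist x y ≤ δ) :
    2 * ‖(hamiltonian Φ {j} (Function.update η j x) - hamiltonian Φ {j} (Function.update ω j x)) -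
      (hamiltonian Φ {j} (Function.update η j y) - hamiltonian Φ {j} (Function.update ω j y))‖ₑ ≤
      diffSum (interdependence Φ δ j) η ω := by
  classical
  have hs (σ : SpinConf d) := summable_hamiltonian hΦ {j} σ
  have hdist (ζ : SpinConf d) (i : Lattice d) :
      dist (Function.update ζ j x i) (Function.update ζ j y i) ≤ δ := by
    by_cases hi : i = j
    · subst hi; simpa using hxy
    · simpa [hi] using hδ
  -- Exchanging the sums gives each A ∋ j the weight 4 times its modulus times the number of sites
  -- of A other than j where η and ω differ. A term of the energy difference vanishes unless this
  -- number is at least 1.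
  have hdiff : diffSum (interdependence Φ δ j) η ω = ∑' A, if j ∈ A then
      4 * (modulus Φ δ A * ∑' k, if η k = ω k ∨ k ∉ A.erase j then 0 else 1) else 0 := by
    simp_rw [← ENNReal.tsum_mul_left]
    have (A : Finset (Lattice d)) : (if j ∈ A then ∑' k, 4 * (modulus Φ δ A *
        if η k = ω k ∨ k ∉ A.erase j then 0 else 1) else 0) = ∑' k, if j ∈ A then
        4 * (modulus Φ δ A * if η k = ω k ∨ k ∉ A.erase j then 0 else 1) else 0 := by
      split_ifs <;> simp
    simp_rw [this]
    rw [ENNReal.tsum_comm, diffSum]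
    refine tsum_congr fun k => ?_
    by_cases h1 : η k = ω k
    · simp [h1]
    by_cases h2 : k = j
    · subst h2; simp [interdependence]
    · simp only [h1, if_false, interdependence, h2, ← ENNReal.tsum_mul_left]
      refine tsum_congr fun A => ?_
      by_cases h3 : k ∈ A <;> simp [h3, h2]
  rw [hamiltonian, hamiltonian, hamiltonian, hamiltonian, ← (hs _).tsum_sub (hs _),
    ← (hs _).tsum_sub (hs _), ← ((hs _).sub (hs _)).tsum_sub ((hs _).sub (hs _)), hdiff]
  refine (mul_le_mul_right enorm_tsum_le_tsum_enorm _).trans ?_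
  rw [← ENNReal.tsum_mul_left]
  refine ENNReal.tsum_le_tsum fun A => ?_
  by_cases hj : j ∈ A
  swap
  · simp [Finset.inter_singleton_of_notMem hj, hj]
  simp only [Finset.inter_singleton_of_mem hj, Finset.singleton_nonempty, if_true, hj]
  by_cases hA : ∀ i ∈ A, i ≠ j → η i = ω i
  · have (z : Sphere1) : Φ A (Function.update η j z) = Φ A (Function.update ω j z) := by
      refine hΦ.local_dep A _ _ fun i hi => ?_
      by_cases hij : i = j
      · subst hij; simp
      · simpa [hij] using hA i hi hij
    simp [this]
  · push Not at hA
    obtain ⟨i, hi, hij, hne⟩ := hA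
    have h1 : (1 : ℝ≥0∞) ≤ ∑' k, if η k = ω k ∨ k ∉ A.erase j then 0 else 1 := by
      refine le_trans ?_ (ENNReal.le_tsum i)
      simp [hi, hij, hne]
    calc _ ≤ 2 * (modulus Φ δ A + modulus Φ δ A) := by
          gcongr
          rw [sub_sub_sub_comm]
          exact (enorm_sub_le).trans (add_le_add (le_modulus A (hdist η)) (le_modulus A (hdist ω)))
      _ = 4 * (modulus Φ δ A * 1) := by ring
      _ ≤ _ := by gcongr

end Potential

/-! ### Arcs of the circle and Lebesgue measure on them. -/

section Arc

variable {d q : ℕ} [NeZero q]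

theorem coe_angle (x : Sphere1) : ((angle x : ℝ) : Sphere1) = x :=
  (AddCircle.equivIco (2 * Real.pi) 0).symm_apply_apply x

theorem angle_coe {a : ℝ} (h0 : 0 ≤ a) (h1 : a < 2 * Real.pi) : angle (a : Sphere1) = a := by
  have := (AddCircle.equivIco (2 * Real.pi) 0).apply_symm_apply ⟨a, h0, by simpa using h1⟩
  exact congrArg Subtype.val this

theorem dist_le_of_discretize_eq {x y : Sphere1} (h : discretize q x = discretize q y) :
    dist x y ≤ 2 * Real.pi / q := by
  obtain ⟨h1, h2⟩ := (discretize_eq_iff q x _).1 h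
  obtain ⟨h3, h4⟩ := (discretize_eq_iff q y _).1 rfl
  have h5 : dist x y ≤ |angle x - angle y| := by
    rw [dist_eq_norm]
    nth_rewrite 1 [← coe_angle x, ← coe_angle y]
    rw [← AddCircle.coe_sub]
    exact QuotientAddGroup.norm_mk_le_norm
  refine h5.trans ?_
  have h6 : 2 * Real.pi * (((discretize q y : Fin q) : ℕ) + 1 : ℝ) / q =
      2 * Real.pi * ((discretize q y : Fin q) : ℕ) / q + 2 * Real.pi / q := by ring
  rw [h6] at h2 h4
  rw [abs_le]
  constructor <;> linarith

theorem measurableSet_arc (k : Fin q) : MeasurableSet {x : Sphere1 | discretize q x = k} :=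
  measurable_discretize q (measurableSet_singleton k)

/-- Lebesgue measure on the arc prescribed by `σ'` at the site `i`. -/
def arcMeasure (σ' : DiscConf d q) (i : Lattice d) : Measure Sphere1 :=
  volume.restrict {x | discretize q x = σ' i}

instance (σ' : DiscConf d q) (i : Lattice d) : IsFiniteMeasure (arcMeasure σ' i) := by
  unfold arcMeasure
  infer_instance

theorem arcMeasure_ne_zero (σ' : DiscConf d q) (i : Lattice d) : arcMeasure σ' i ≠ 0 := by
  have hq : (0 : ℝ) < q := by exact_mod_cast Nat.pos_of_ne_zero (NeZero.ne q)
  have hp := Real.two_pi_pos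
  rw [arcMeasure, Ne, Measure.restrict_eq_zero]
  set k := σ' i
  set U : Set ℝ := Ioo (2 * Real.pi * (k : ℕ) / q) (2 * Real.pi * ((k : ℕ) + 1) / q)
  have hU : IsOpen ((fun a : ℝ => (a : Sphere1)) '' U) :=
    QuotientAddGroup.isOpenMap_coe _ isOpen_Ioo
  have hne : U.Nonempty := by
    rw [nonempty_Ioo]
    gcongr
    linarith
  refine (lt_of_lt_of_le (hU.measure_pos volume (hne.image _)) (measure_mono ?_)).ne'
  rintro _ ⟨a, ha, rfl⟩
  have h0 : 0 ≤ a := le_trans (by positivity) ha.1.le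
  have h1 : a < 2 * Real.pi := by
    refine ha.2.trans_le ?_
    rw [div_le_iff₀ hq]
    gcongr
    exact_mod_cast k.2
  refine (discretize_eq_iff q _ k).2 ?_
  rw [angle_coe h0 h1]
  exact ⟨ha.1.le, ha.2⟩

/-- The constraint factorizes over sites, so it can be absorbed into the reference measure and the
marginal calculus of product measures applies. -/
theorem pi_arcMeasure (σ' : DiscConf d q) (Λ : Finset (Lattice d)) :
    (Measure.pi fun i : Λ => arcMeasure σ' i) =
      volume.restrict {x : Λ → Sphere1 | ∀ i : Λ, discretize q (x i) = σ' i} := by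
  have := Measure.restrict_pi_pi (fun _ : Λ => (volume : Measure Sphere1))
    fun i => {x | discretize q x = σ' i}
  rw [volume_pi]
  simp only [arcMeasure]
  rw [← this]
  congr 1
  ext x
  simp

end Arc

/-! ### The constrained specification: kernels, DLR equations and consistency. -/

section Specification

variable {d q : ℕ} [NeZero q] {Φ : Potential d}

/-- The Boltzmann factor `e^{-H_Λ}`. -/
def boltzmann (Φ : Potential d) (Λ : Finset (Lattice d)) (σ : SpinConf d) : ℝ≥0∞ :=
  ENNReal.ofReal (Real.exp (-hamiltonian Φ Λ σ))

theorem continuous_boltzmann (hΦ : IsAdmissible Φ) (Λ : Finset (Lattice d)) :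
    Continuous (boltzmann Φ Λ) :=
  ENNReal.continuous_ofReal.comp (Real.continuous_exp.comp (continuous_hamiltonian hΦ Λ).neg)

theorem measurable_boltzmann (hΦ : IsAdmissible Φ) (Λ : Finset (Lattice d)) :
    Measurable (boltzmann Φ Λ) := (continuous_boltzmann hΦ Λ).measurable

theorem measurable_boltzmann_updateFinset (hΦ : IsAdmissible Φ) (Λ Δ : Finset (Lattice d))
    (η : SpinConf d) : Measurable fun x : Δ → Sphere1 =>
      boltzmann Φ Λ (Function.updateFinset η Δ x) :=
  (measurable_boltzmann hΦ Λ).comp measurable_updateFinset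

theorem boltzmann_ne_zero (Λ : Finset (Lattice d)) (σ : SpinConf d) : boltzmann Φ Λ σ ≠ 0 := by
  simpa [boltzmann] using Real.exp_pos _

theorem boltzmann_ne_top (Λ : Finset (Lattice d)) (σ : SpinConf d) : boltzmann Φ Λ σ ≠ ∞ :=
  ENNReal.ofReal_ne_top

theorem exists_boltzmann_le (hΦ : IsAdmissible Φ) (Λ : Finset (Lattice d)) :
    ∃ M : ℝ, ∀ σ, Real.exp (-hamiltonian Φ Λ σ) ≤ M := by
  obtain ⟨M, hM⟩ := (isCompact_range
    (Real.continuous_exp.comp (continuous_hamiltonian hΦ Λ).neg)).bddAbove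
  exact ⟨M, fun σ => hM ⟨σ, rfl⟩⟩

theorem boltzmann_eq_mul {Λ Δ : Finset (Lattice d)} (σ : SpinConf d) :
    boltzmann Φ Δ σ = boltzmann Φ Λ σ *
      ENNReal.ofReal (Real.exp (-(hamiltonian Φ Δ σ - hamiltonian Φ Λ σ))) := by
  rw [boltzmann, boltzmann, ← ENNReal.ofReal_mul (Real.exp_pos _).le, ← Real.exp_add]
  congr 2
  ring

theorem glue_eq_updateFinset (Λ : Finset (Lattice d)) (x : Λ → Sphere1) (η : SpinConf d) :
    glue Λ x η = Function.updateFinset η Λ x := by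
  ext i
  simp only [glue, Function.updateFinset]

/-- The partition function of the constrained model. -/
def partitionFn (Φ : Potential d) (σ' : DiscConf d q) (Λ : Finset (Lattice d)) :
    SpinConf d → ℝ≥0∞ := ∫⋯∫⁻_Λ, boltzmann Φ Λ ∂arcMeasure σ'

theorem partitionFn_ne_zero (hΦ : IsAdmissible Φ) (σ' : DiscConf d q) (Λ : Finset (Lattice d))
    (η : SpinConf d) : partitionFn Φ σ' Λ η ≠ 0 := by
  rw [partitionFn, lmarginal, Ne,
    lintegral_eq_zero_iff (measurable_boltzmann_updateFinset hΦ Λ Λ _)]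
  intro h
  have h1 : ∀ᵐ y ∂(Measure.pi fun i : Λ => arcMeasure σ' i), False :=
    h.mono fun y hy => boltzmann_ne_zero Λ _ hy
  rw [Filter.eventually_false_iff_eq_bot, ae_eq_bot, ← Measure.measure_univ_eq_zero,
    Measure.pi_univ, Finset.prod_eq_zero_iff] at h1
  obtain ⟨i, -, hi⟩ := h1
  exact arcMeasure_ne_zero σ' i (Measure.measure_univ_eq_zero.1 hi)

theorem partitionFn_ne_top (hΦ : IsAdmissible Φ) (σ' : DiscConf d q) (Λ : Finset (Lattice d))
    (η : SpinConf d) : partitionFn Φ σ' Λ η ≠ ∞ := by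
  obtain ⟨M, hM⟩ := exists_boltzmann_le hΦ Λ
  refine ne_top_of_le_ne_top ?_ (lintegral_mono (g := fun _ => ENNReal.ofReal M) fun y =>
    ENNReal.ofReal_le_ofReal (hM _))
  rw [lintegral_const]
  exact ENNReal.mul_ne_top ENNReal.ofReal_ne_top (measure_ne_top _ _)

theorem measurable_partitionFn (hΦ : IsAdmissible Φ) (σ' : DiscConf d q)
    (Λ : Finset (Lattice d)) : Measurable (partitionFn Φ σ' Λ) :=
  (measurable_boltzmann hΦ Λ).lmarginal _

/-- The conditional expectation `γ_Λ f` of the constrained specification. -/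
def gibbsAverage (Φ : Potential d) (σ' : DiscConf d q) (Λ : Finset (Lattice d))
    (f : SpinConf d → ℝ≥0∞) (η : SpinConf d) : ℝ≥0∞ :=
  (partitionFn Φ σ' Λ η)⁻¹ * (∫⋯∫⁻_Λ, (fun σ => f σ * boltzmann Φ Λ σ) ∂arcMeasure σ') η

theorem measurable_gibbsAverage (hΦ : IsAdmissible Φ) (σ' : DiscConf d q)
    (Λ : Finset (Lattice d)) {f : SpinConf d → ℝ≥0∞} (hf : Measurable f) :
    Measurable (gibbsAverage Φ σ' Λ f) :=
  (measurable_partitionFn hΦ σ' Λ).inv.mul ((hf.mul (measurable_boltzmann hΦ Λ)).lmarginal _)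

theorem constrainedWeight_eq (σ' : DiscConf d q) (Λ : Finset (Lattice d)) (η : SpinConf d)
    {B : Set (SpinConf d)} (hB : MeasurableSet B) :
    constrainedWeight Φ σ' Λ η B =
      (∫⋯∫⁻_Λ, (fun σ => B.indicator 1 σ * boltzmann Φ Λ σ) ∂arcMeasure σ') η := by
  have hm : MeasurableSet {x : Λ → Sphere1 | Function.updateFinset η Λ x ∈ B} :=
    measurable_updateFinset hB
  rw [constrainedWeight, lmarginal, pi_arcMeasure]
  simp_rw [glue_eq_updateFinset]
  have : {x : Λ → Sphere1 | Function.updateFinset η Λ x ∈ B ∧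
      ∀ i : Λ, discretize q (x i) = σ' i} = {x : Λ → Sphere1 | Function.updateFinset η Λ x ∈ B} ∩
        {x | ∀ i : Λ, discretize q (x i) = σ' i} := rfl
  rw [this, ← Measure.restrict_restrict hm, ← lintegral_indicator hm]
  refine lintegral_congr fun x => ?_
  by_cases hx : Function.updateFinset η Λ x ∈ B
  · rw [indicator_of_mem hx, indicator_of_mem (by exact hx)]
    simp [boltzmann]
  · rw [indicator_of_notMem hx, indicator_of_notMem (by exact hx)]
    simp

theorem constrainedSpec_eq (σ' : DiscConf d q) (Λ : Finset (Lattice d)) (η : SpinConf d)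
    {B : Set (SpinConf d)} (hB : MeasurableSet B) :
    constrainedSpec Φ σ' Λ η B = gibbsAverage Φ σ' Λ (B.indicator 1) η := by
  rw [constrainedSpec, constrainedWeight_eq σ' Λ η hB, constrainedWeight_eq σ' Λ η .univ,
    gibbsAverage, partitionFn, ENNReal.div_eq_inv_mul]
  simp

/-- The kernel `γ_Λ(· | η)` as a measure. -/
def gibbsMeasure (Φ : Potential d) (σ' : DiscConf d q) (Λ : Finset (Lattice d))
    (η : SpinConf d) : Measure (SpinConf d) :=
  (partitionFn Φ σ' Λ η)⁻¹ • (((Measure.pi fun i : Λ => arcMeasure σ' i).withDensity fun x =>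
    boltzmann Φ Λ (Function.updateFinset η Λ x)).map (Function.updateFinset η Λ))

theorem lintegral_gibbsMeasure (hΦ : IsAdmissible Φ) (σ' : DiscConf d q)
    (Λ : Finset (Lattice d)) (η : SpinConf d) {f : SpinConf d → ℝ≥0∞} (hf : Measurable f) :
    ∫⁻ σ, f σ ∂gibbsMeasure Φ σ' Λ η = gibbsAverage Φ σ' Λ f η := by
  have hb := measurable_boltzmann_updateFinset hΦ Λ Λ η
  have hf' : Measurable fun x : Λ → Sphere1 => f (Function.updateFinset η Λ x) :=
    hf.comp measurable_updateFinset
  rw [gibbsMeasure, lintegral_smul_measure, lintegral_map hf measurable_updateFinset,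
    lintegral_withDensity_eq_lintegral_mul _ hb hf', gibbsAverage, smul_eq_mul, lmarginal]
  simp only [Pi.mul_apply, mul_comm]

theorem gibbsAverage_const (hΦ : IsAdmissible Φ) (σ' : DiscConf d q) (Λ : Finset (Lattice d))
    (η : SpinConf d) (a : ℝ≥0∞) : gibbsAverage Φ σ' Λ (fun _ => a) η = a := by
  have : (∫⋯∫⁻_Λ, (fun σ => a * boltzmann Φ Λ σ) ∂arcMeasure σ') η =
      a * partitionFn Φ σ' Λ η :=
    lintegral_const_mul _ (measurable_boltzmann_updateFinset hΦ Λ Λ _)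
  rw [gibbsAverage, this, mul_comm, mul_assoc,
    ENNReal.mul_inv_cancel (partitionFn_ne_zero hΦ σ' Λ η) (partitionFn_ne_top hΦ σ' Λ η), mul_one]

theorem isProbabilityMeasure_gibbsMeasure (hΦ : IsAdmissible Φ) (σ' : DiscConf d q)
    (Λ : Finset (Lattice d)) (η : SpinConf d) :
    IsProbabilityMeasure (gibbsMeasure Φ σ' Λ η) := by
  constructor
  rw [← lintegral_one, lintegral_gibbsMeasure hΦ σ' Λ η measurable_const,
    gibbsAverage_const hΦ]

theorem gibbsMeasure_apply (hΦ : IsAdmissible Φ) (σ' : DiscConf d q) (Λ : Finset (Lattice d))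
    (η : SpinConf d) {B : Set (SpinConf d)} (hB : MeasurableSet B) :
    gibbsMeasure Φ σ' Λ η B = constrainedSpec Φ σ' Λ η B := by
  rw [← lintegral_indicator_one hB, lintegral_gibbsMeasure hΦ σ' Λ η (measurable_one.indicator hB),
    constrainedSpec_eq σ' Λ η hB]

theorem measurable_gibbsMeasure (hΦ : IsAdmissible Φ) (σ' : DiscConf d q)
    (Λ : Finset (Lattice d)) : Measurable (gibbsMeasure Φ σ' Λ) := by
  refine Measure.measurable_of_measurable_coe _ fun B hB => ?_
  simp_rw [gibbsMeasure_apply hΦ σ' Λ _ hB, constrainedSpec_eq σ' Λ _ hB]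
  exact measurable_gibbsAverage hΦ σ' Λ (measurable_one.indicator hB)

theorem isConstrainedGibbs_iff (hΦ : IsAdmissible Φ) (σ' : DiscConf d q)
    {μ : Measure (SpinConf d)} [IsProbabilityMeasure μ] :
    IsConstrainedGibbs Φ σ' μ ↔ ∀ Λ, μ.bind (gibbsMeasure Φ σ' Λ) = μ := by
  refine ⟨fun h Λ => ?_, fun h => ⟨inferInstance, fun Λ B hB => ?_⟩⟩
  · ext B hB
    rw [Measure.bind_apply hB (measurable_gibbsMeasure hΦ σ' Λ).aemeasurable, ← h.2 Λ B hB]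
    exact lintegral_congr fun η => gibbsMeasure_apply hΦ σ' Λ η hB
  · conv_rhs => rw [← h Λ]
    rw [Measure.bind_apply hB (measurable_gibbsMeasure hΦ σ' Λ).aemeasurable]
    exact lintegral_congr fun η => (gibbsMeasure_apply hΦ σ' Λ η hB).symm

theorem IsConstrainedGibbs.lintegral_gibbsAverage (hΦ : IsAdmissible Φ) {σ' : DiscConf d q}
    {μ : Measure (SpinConf d)} (h : IsConstrainedGibbs Φ σ' μ) (Λ : Finset (Lattice d))
    {f : SpinConf d → ℝ≥0∞} (hf : Measurable f) :
    ∫⁻ η, gibbsAverage Φ σ' Λ f η ∂μ = ∫⁻ σ, f σ ∂μ := by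
  have := h.1
  conv_rhs => rw [← (isConstrainedGibbs_iff hΦ σ').1 h Λ]
  rw [Measure.lintegral_bind (measurable_gibbsMeasure hΦ σ' Λ).aemeasurable hf.aemeasurable]
  exact lintegral_congr fun η => (lintegral_gibbsMeasure hΦ σ' Λ η hf).symm

theorem gibbsAverage_congr {σ' : DiscConf d q} {Λ : Finset (Lattice d)}
    (f : SpinConf d → ℝ≥0∞) {η ω : SpinConf d} (h : ∀ i ∉ Λ, η i = ω i) :
    gibbsAverage Φ σ' Λ f η = gibbsAverage Φ σ' Λ f ω := by
  rw [gibbsAverage, gibbsAverage, partitionFn, lmarginal_congr _ _ h, lmarginal_congr _ _ h]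

theorem updateFinset_of_notMem {Λ : Finset (Lattice d)} (η : SpinConf d) (x : Λ → Sphere1)
    {i : Lattice d} (hi : i ∉ Λ) : Function.updateFinset η Λ x i = η i := by
  simp [Function.updateFinset, hi]

/-- Consistency of the constrained specification. -/
theorem gibbsAverage_gibbsAverage (hΦ : IsAdmissible Φ) (σ' : DiscConf d q)
    {Λ Δ : Finset (Lattice d)} (h : Λ ⊆ Δ) {f : SpinConf d → ℝ≥0∞} (hf : Measurable f) :
    gibbsAverage Φ σ' Δ (gibbsAverage Φ σ' Λ f) = gibbsAverage Φ σ' Δ f := by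
  -- H_Δ - H_Λ is constant under integration over Λ and leaves the integral.
  have hpull (g : SpinConf d → ℝ≥0∞) (hg : Measurable g) (η : SpinConf d) :
      (∫⋯∫⁻_Λ, (fun σ => g σ * boltzmann Φ Δ σ) ∂arcMeasure σ') η =
        (∫⋯∫⁻_Λ, (fun σ => g σ * boltzmann Φ Λ σ) ∂arcMeasure σ') η *
          ENNReal.ofReal (Real.exp (-(hamiltonian Φ Δ η - hamiltonian Φ Λ η))) := by
    have hg' : Measurable fun x : Λ → Sphere1 => g (Function.updateFinset η Λ x) :=
      hg.comp measurable_updateFinset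
    rw [lmarginal, lmarginal, ← lintegral_mul_const _
      (hg'.fun_mul (measurable_boltzmann_updateFinset hΦ Λ Λ η))]
    refine lintegral_congr fun x => ?_
    rw [boltzmann_eq_mul (Λ := Λ), hamiltonian_sub_congr hΦ h fun i hi =>
      updateFinset_of_notMem η x hi, mul_assoc]
  have hm := measurable_gibbsAverage hΦ σ' Λ hf
  ext η
  rw [gibbsAverage, gibbsAverage]
  congr 1
  refine congrFun (lmarginal_eq_of_subset h (hm.mul (measurable_boltzmann hΦ Δ))
    (hf.mul (measurable_boltzmann hΦ Δ)) ?_) η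
  ext ζ
  refine (hpull _ hm ζ).trans (Eq.trans ?_ (hpull _ hf ζ).symm)
  congr 1
  have : (∫⋯∫⁻_Λ, (fun σ => gibbsAverage Φ σ' Λ f σ * boltzmann Φ Λ σ) ∂arcMeasure σ') ζ =
      gibbsAverage Φ σ' Λ f ζ * partitionFn Φ σ' Λ ζ := by
    rw [partitionFn, lmarginal, lmarginal, ← lintegral_const_mul _
      (measurable_boltzmann_updateFinset hΦ Λ Λ _)]
    refine lintegral_congr fun x => ?_
    rw [gibbsAverage_congr f fun i hi => updateFinset_of_notMem ζ x hi]
  rw [this, gibbsAverage, mul_comm, ← mul_assoc,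
    ENNReal.mul_inv_cancel (partitionFn_ne_zero hΦ σ' Λ ζ) (partitionFn_ne_top hΦ σ' Λ ζ), one_mul]

end Specification

/-! ### Existence of a Gibbs measure by compactness. -/

section Existence

open scoped NNReal BoundedContinuousFunction
open Filter Topology

variable {d q : ℕ} [NeZero q] {Φ : Potential d}

theorem continuous_updateFinset_left (Λ : Finset (Lattice d)) (x : Λ → Sphere1) :
    Continuous fun η : SpinConf d => Function.updateFinset η Λ x := by
  refine continuous_pi fun i => ?_
  by_cases hi : i ∈ Λ
  · simpa [Function.updateFinset, hi] using continuous_const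
  · simpa [Function.updateFinset, hi] using continuous_apply i

theorem continuous_lmarginal (σ' : DiscConf d q) (Λ : Finset (Lattice d))
    {F : SpinConf d → ℝ≥0∞} (hF : Continuous F) {M : ℝ≥0∞} (hM : M ≠ ∞) (hFM : ∀ σ, F σ ≤ M) :
    Continuous (∫⋯∫⁻_Λ, F ∂arcMeasure σ') := by
  refine continuous_iff_continuousAt.2 fun η => ?_
  refine tendsto_lintegral_filter_of_dominated_convergence (fun _ => M)
    (Eventually.of_forall fun ζ => hF.measurable.comp measurable_updateFinset)
    (Eventually.of_forall fun ζ => Eventually.of_forall fun x => hFM _) ?_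
    (Eventually.of_forall fun x => ?_)
  · rw [lintegral_const]
    exact ENNReal.mul_ne_top hM (measure_ne_top _ _)
  · exact (hF.comp (continuous_updateFinset_left Λ x)).tendsto η

theorem continuous_gibbsAverage (hΦ : IsAdmissible Φ) (σ' : DiscConf d q)
    (Λ : Finset (Lattice d)) (f : SpinConf d →ᵇ ℝ≥0) :
    Continuous (gibbsAverage Φ σ' Λ fun σ => f σ) := by
  obtain ⟨M, hM⟩ := exists_boltzmann_le hΦ Λ
  have hb (σ : SpinConf d) : boltzmann Φ Λ σ ≤ ENNReal.ofReal M := ENNReal.ofReal_le_ofReal (hM σ)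
  have hf (σ : SpinConf d) : (f σ : ℝ≥0∞) ≤ (nndist f 0 : ℝ≥0) := by
    have := BoundedContinuousFunction.NNReal.upper_bound f σ
    exact_mod_cast this
  have hfb : Continuous fun σ => (f σ : ℝ≥0∞) * boltzmann Φ Λ σ :=
    continuous_iff_continuousAt.2 fun σ => ENNReal.Tendsto.mul
      ((ENNReal.continuous_coe.comp f.continuous).tendsto σ) (Or.inr (boltzmann_ne_top Λ σ))
      ((continuous_boltzmann hΦ Λ).tendsto σ) (Or.inr ENNReal.coe_ne_top)
  have hnum := continuous_lmarginal σ' Λ hfb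
    (ENNReal.mul_ne_top ENNReal.coe_ne_top ENNReal.ofReal_ne_top) fun σ => mul_le_mul' (hf σ) (hb σ)
  have hden := continuous_lmarginal σ' Λ (continuous_boltzmann hΦ Λ) ENNReal.ofReal_ne_top hb
  refine continuous_iff_continuousAt.2 fun η => ENNReal.Tendsto.mul
    (tendsto_inv_iff.2 (hden.tendsto η)) (Or.inl ?_) (hnum.tendsto η) (Or.inr ?_)
  · exact ENNReal.inv_ne_zero.2 (partitionFn_ne_top hΦ σ' Λ η)
  · exact ENNReal.inv_ne_top.2 (partitionFn_ne_zero hΦ σ' Λ η)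

theorem gibbsAverage_mono (σ' : DiscConf d q) (Λ : Finset (Lattice d))
    {f g : SpinConf d → ℝ≥0∞} (h : ∀ σ, f σ ≤ g σ) (η : SpinConf d) :
    gibbsAverage Φ σ' Λ f η ≤ gibbsAverage Φ σ' Λ g η :=
  mul_le_mul_right (lmarginal_mono (fun σ => mul_le_mul_left (h σ) _) η) _

/-- The Feller property of the constrained specification. -/
theorem exists_boundedContinuous_gibbsAverage (hΦ : IsAdmissible Φ) (σ' : DiscConf d q)
    (Λ : Finset (Lattice d)) (f : SpinConf d →ᵇ ℝ≥0) :
    ∃ g : SpinConf d →ᵇ ℝ≥0, ∀ η, (g η : ℝ≥0∞) = gibbsAverage Φ σ' Λ (fun σ => f σ) η := by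
  have hle (η : SpinConf d) : gibbsAverage Φ σ' Λ (fun σ => f σ) η ≤ (nndist f 0 : ℝ≥0) := by
    refine (gibbsAverage_mono σ' Λ (fun σ => ?_) η).trans_eq
      (gibbsAverage_const hΦ σ' Λ η (nndist f 0 : ℝ≥0))
    have := BoundedContinuousFunction.NNReal.upper_bound f σ
    exact_mod_cast this
  have htop (η : SpinConf d) : gibbsAverage Φ σ' Λ (fun σ => f σ) η ≠ ∞ :=
    ne_top_of_le_ne_top ENNReal.coe_ne_top (hle η)
  have hc : Continuous fun η => (gibbsAverage Φ σ' Λ (fun σ => f σ) η).toNNReal :=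
    continuous_iff_continuousAt.2 fun η =>
      (ENNReal.tendsto_toNNReal (htop η)).comp ((continuous_gibbsAverage hΦ σ' Λ f).tendsto η)
  exact ⟨BoundedContinuousFunction.mkOfCompact ⟨_, hc⟩, fun η => ENNReal.coe_toNNReal (htop η)⟩

instance : TopologicalSpace.MetrizableSpace (SpinConf d) :=
  TopologicalSpace.metrizableSpace_of_t3_secondCountable _

/-- A limit of γ_Δ(· | 0) along an ultrafilter containing all {Δ ⊇ Λ}. Consistency gives invariance
under γ_Λ once Δ ⊇ Λ, and the Feller property carries it to the limit. -/
theorem exists_isConstrainedGibbs (hΦ : IsAdmissible Φ) (σ' : DiscConf d q) :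
    ∃ μ : Measure (SpinConf d), IsConstrainedGibbs Φ σ' μ := by
  let P : Finset (Lattice d) → ProbabilityMeasure (SpinConf d) := fun Δ =>
    ⟨gibbsMeasure Φ σ' Δ 0, isProbabilityMeasure_gibbsMeasure hΦ σ' Δ 0⟩
  let U : Ultrafilter (Finset (Lattice d)) := Ultrafilter.of atTop
  obtain ⟨μ, -, hμ⟩ := isCompact_univ.ultrafilter_le_nhds (U.map P) (by simp)
  have hlim := ProbabilityMeasure.tendsto_iff_forall_lintegral_tendsto.1
    (show Tendsto P U (𝓝 μ) from hμ)
  refine ⟨μ, (isConstrainedGibbs_iff hΦ σ').2 fun Λ => ?_⟩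
  have hm := measurable_gibbsMeasure hΦ σ' Λ
  have hprob : IsProbabilityMeasure ((μ : Measure (SpinConf d)).bind (gibbsMeasure Φ σ' Λ)) := by
    constructor
    rw [Measure.bind_apply .univ hm.aemeasurable]
    simp [fun η => (isProbabilityMeasure_gibbsMeasure hΦ σ' Λ η).measure_univ]
  refine ext_of_forall_lintegral_eq_of_IsFiniteMeasure fun f => ?_
  have hf : Measurable fun σ => (f σ : ℝ≥0∞) :=
    (ENNReal.continuous_coe.comp f.continuous).measurable
  obtain ⟨g, hg⟩ := exists_boundedContinuous_gibbsAverage hΦ σ' Λ f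
  have hgm : Measurable fun σ => (g σ : ℝ≥0∞) :=
    (ENNReal.continuous_coe.comp g.continuous).measurable
  rw [Measure.lintegral_bind hm.aemeasurable hf.aemeasurable]
  simp_rw [lintegral_gibbsMeasure hΦ σ' Λ _ hf, ← hg]
  refine tendsto_nhds_unique (hlim g) ((hlim f).congr' ?_)
  have hev : ∀ᶠ Δ in (U : Filter (Finset (Lattice d))), Λ ≤ Δ :=
    (Ultrafilter.of_le atTop) (eventually_ge_atTop Λ)
  filter_upwards [hev] with Δ hΔ
  change ∫⁻ σ, f σ ∂gibbsMeasure Φ σ' Δ 0 = ∫⁻ σ, g σ ∂gibbsMeasure Φ σ' Δ 0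
  rw [lintegral_gibbsMeasure hΦ σ' Δ 0 hf, lintegral_gibbsMeasure hΦ σ' Δ 0 hgm]
  simp_rw [hg]
  rw [gibbsAverage_gibbsAverage hΦ σ' hΔ hf]

end Existence

/-! ### From bounds on densities to bounds on integrals. -/

section TotalVariation

variable {S : Type*} {g : S → ℝ≥0∞} {r : ℝ≥0∞}

theorem le_iInf_add (h : ∀ x y, g x ≤ g y + r) (x : S) : g x ≤ (⨅ y, g y) + r := by
  rw [ENNReal.iInf_add]
  exact le_iInf fun y => h x y

variable [MeasurableSpace S] {ρ ρ' : Measure S} [IsProbabilityMeasure ρ]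
  [IsProbabilityMeasure ρ']

theorem iInf_le_lintegral (g : S → ℝ≥0∞) : ⨅ x, g x ≤ ∫⁻ x, g x ∂ρ := by
  calc ⨅ x, g x = ∫⁻ _, ⨅ x, g x ∂ρ := by simp
    _ ≤ _ := lintegral_mono fun x => iInf_le g x

theorem lintegral_le_lintegral_add (h : ∀ x y, g x ≤ g y + r) :
    ∫⁻ x, g x ∂ρ ≤ ∫⁻ x, g x ∂ρ' + r := by
  calc ∫⁻ x, g x ∂ρ ≤ ∫⁻ _, ((⨅ y, g y) + r) ∂ρ := lintegral_mono (le_iInf_add h)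
    _ = (⨅ y, g y) + r := by simp
    _ ≤ _ := by gcongr; exact iInf_le_lintegral g

/-- After subtraction of its infimum g is at most r, so the factor 1 + κ costs only r κ. -/
theorem lintegral_le_lintegral_add_mul {κ : ℝ≥0∞} (hg : Measurable g)
    (hρ : ∀ f : S → ℝ≥0∞, Measurable f → ∫⁻ x, f x ∂ρ ≤ (1 + κ) * ∫⁻ x, f x ∂ρ')
    (h : ∀ x y, g x ≤ g y + r) : ∫⁻ x, g x ∂ρ ≤ ∫⁻ x, g x ∂ρ' + r * κ := by
  set m := ⨅ y, g y
  have hgm (x : S) : g x = m + (g x - m) := (add_tsub_cancel_of_le (iInf_le g x)).symm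
  have hm : Measurable fun x => g x - m := hg.sub_const m
  have hint (τ : Measure S) [IsProbabilityMeasure τ] :
      ∫⁻ x, g x ∂τ = m + ∫⁻ x, (g x - m) ∂τ := by
    conv_lhs => enter [2, x]; rw [hgm x]
    rw [lintegral_add_left measurable_const]
    simp
  have hr : ∫⁻ x, (g x - m) ∂ρ' ≤ r := by
    calc ∫⁻ x, (g x - m) ∂ρ' ≤ ∫⁻ _, r ∂ρ' :=
          lintegral_mono fun x => tsub_le_iff_left.2 (le_iInf_add h x)
      _ = r := by simp
  rw [hint ρ, hint ρ', add_assoc]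
  gcongr
  refine (hρ _ hm).trans ?_
  rw [add_mul, one_mul, mul_comm κ]
  gcongr

end TotalVariation

/-! ### Interdependence of the single-site laws. -/

section SingleSite

variable {d q : ℕ} [NeZero q] {Φ : Potential d}

/-- The law of the spin at `j` under `γ_{j}(· | η)`. -/
def siteLaw (Φ : Potential d) (σ' : DiscConf d q) (j : Lattice d) (η : SpinConf d) :
    Measure Sphere1 :=
  (partitionFn Φ σ' {j} η)⁻¹ •
    (arcMeasure σ' j).withDensity fun x => boltzmann Φ {j} (Function.update η j x)

theorem measurable_boltzmann_update (hΦ : IsAdmissible Φ) (j : Lattice d) (η : SpinConf d) :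
    Measurable fun x => boltzmann Φ {j} (Function.update η j x) :=
  (measurable_boltzmann hΦ {j}).comp (measurable_update η)

theorem lintegral_siteLaw (hΦ : IsAdmissible Φ) (σ' : DiscConf d q) (j : Lattice d)
    (η : SpinConf d) {g : Sphere1 → ℝ≥0∞} (hg : Measurable g) :
    ∫⁻ x, g x ∂siteLaw Φ σ' j η = ∫⁻ x, g x * ((partitionFn Φ σ' {j} η)⁻¹ *
      boltzmann Φ {j} (Function.update η j x)) ∂arcMeasure σ' j := by
  have hb := measurable_boltzmann_update hΦ j η
  rw [siteLaw, lintegral_smul_measure, lintegral_withDensity_eq_lintegral_mul _ hb hg,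
    smul_eq_mul, ← lintegral_const_mul _ (hb.mul hg)]
  refine lintegral_congr fun x => ?_
  simp only [Pi.mul_apply]
  ring

theorem siteAverage_siteLaw (hΦ : IsAdmissible Φ) (σ' : DiscConf d q) (j : Lattice d)
    {f : SpinConf d → ℝ≥0∞} (hf : Measurable f) :
    siteAverage (siteLaw Φ σ') j f = gibbsAverage Φ σ' {j} f := by
  ext η
  have hb := measurable_boltzmann_update hΦ j η
  have hf' : Measurable fun x => f (Function.update η j x) := hf.comp (measurable_update η)
  rw [siteAverage, lintegral_siteLaw hΦ σ' j η hf', gibbsAverage, lmarginal_singleton,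
    ← lintegral_const_mul _ (hf'.fun_mul hb)]
  exact lintegral_congr fun x => by ring

theorem isProbabilityMeasure_siteLaw (hΦ : IsAdmissible Φ) (σ' : DiscConf d q) (j : Lattice d)
    (η : SpinConf d) : IsProbabilityMeasure (siteLaw Φ σ' j η) := by
  constructor
  have := congrFun (siteAverage_siteLaw hΦ σ' j (f := fun _ => 1) measurable_const) η
  rw [gibbsAverage_const hΦ, siteAverage, lintegral_one] at this
  exact this

theorem siteLaw_congr {σ' ω' : DiscConf d q} {j : Lattice d} (h : σ' j = ω' j) (η : SpinConf d) :
    siteLaw Φ σ' j η = siteLaw Φ ω' j η := by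
  have : arcMeasure σ' j = arcMeasure ω' j := by rw [arcMeasure, arcMeasure, h]
  rw [siteLaw, siteLaw, partitionFn, partitionFn, lmarginal_singleton, lmarginal_singleton, this]

theorem exp_le_one_add_two_mul {ε : ℝ} (h0 : 0 ≤ ε) (h1 : ε ≤ 1 / 2) :
    Real.exp ε ≤ 1 + 2 * ε := by
  have h2 := Real.one_sub_le_exp_neg ε
  have h3 : Real.exp (-ε) * Real.exp ε = 1 := by rw [← Real.exp_add]; simp
  have h4 := Real.exp_pos ε
  nlinarith

theorem isInterdependence_siteLaw (hΦ : IsAdmissible Φ) (σ' : DiscConf d q) :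
    IsInterdependence (siteLaw Φ σ') (interdependence Φ (2 * Real.pi / q)) := by
  intro j η ω g r hg h
  have hδ : 0 ≤ 2 * Real.pi / q := by positivity
  have := isProbabilityMeasure_siteLaw hΦ σ' j η
  have := isProbabilityMeasure_siteLaw hΦ σ' j ω
  set E := diffSum (interdependence Φ (2 * Real.pi / q) j) η ω with hE
  -- For E ≥ 1 the trivial bound r suffices. Otherwise the energy difference is at most E/2 < 1/2,
  -- where e^ε ≤ 1 + 2ε gives the factor 1 + E.
  rcases le_or_gt 1 E with h1 | h1
  · exact (lintegral_le_lintegral_add h).trans (by gcongr; exact le_mul_of_one_le_right' h1)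
  refine lintegral_le_lintegral_add_mul hg (fun f hf => ?_) h
  have hp (x y : Sphere1) (hxy : dist x y ≤ 2 * Real.pi / q) :
      boltzmann Φ {j} (Function.update η j x) * boltzmann Φ {j} (Function.update ω j y) ≤
        (1 + E) * boltzmann Φ {j} (Function.update ω j x) *
          boltzmann Φ {j} (Function.update η j y) := by
    have hen := hamiltonian_singleton_le hΦ hδ j η ω hxy
    rw [← hE] at hen
    simp only [boltzmann]
    set a := hamiltonian Φ {j} (Function.update η j x)
    set b := hamiltonian Φ {j} (Function.update ω j x)
    set a' := hamiltonian Φ {j} (Function.update η j y)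
    set b' := hamiltonian Φ {j} (Function.update ω j y)
    have hE' : ENNReal.ofReal E.toReal = E := ENNReal.ofReal_toReal h1.ne_top
    have hlt : E.toReal < 1 := by
      simpa using (ENNReal.toReal_lt_toReal h1.ne_top ENNReal.one_ne_top).2 h1
    have hab : 2 * |(a - b) - (a' - b')| ≤ E.toReal := by
      have := ENNReal.toReal_mono h1.ne_top hen
      simpa [ENNReal.toReal_mul, toReal_enorm] using this
    have hexp : Real.exp (-((a - b) - (a' - b'))) ≤ 1 + E.toReal := by
      refine (Real.exp_le_exp.2 (neg_le_abs _)).trans ?_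
      exact (exp_le_one_add_two_mul (abs_nonneg _) (by linarith)).trans (by linarith)
    rw [← hE', ← ENNReal.ofReal_one, ← ENNReal.ofReal_add zero_le_one ENNReal.toReal_nonneg,
      ← ENNReal.ofReal_mul (by positivity), ← ENNReal.ofReal_mul (by positivity),
      ← ENNReal.ofReal_mul (by positivity)]
    refine ENNReal.ofReal_le_ofReal ?_
    calc Real.exp (-a) * Real.exp (-b')
        = Real.exp (-((a - b) - (a' - b'))) * Real.exp (-b) * Real.exp (-a') := by
          rw [← Real.exp_add, ← Real.exp_add, ← Real.exp_add]
          congr 1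
          ring
      _ ≤ _ := by gcongr
  have hZ0 (ζ : SpinConf d) := partitionFn_ne_zero hΦ σ' {j} ζ
  have hZt (ζ : SpinConf d) := partitionFn_ne_top hΦ σ' {j} ζ
  have hZ (ζ : SpinConf d) : partitionFn Φ σ' {j} ζ =
      ∫⁻ y in {y | discretize q y = σ' j}, boltzmann Φ {j} (Function.update ζ j y) := by
    rw [partitionFn, lmarginal_singleton]
    rfl
  have hdens (x : Sphere1) (hx : discretize q x = σ' j) :
      (partitionFn Φ σ' {j} η)⁻¹ * boltzmann Φ {j} (Function.update η j x) ≤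
        (1 + E) * ((partitionFn Φ σ' {j} ω)⁻¹ * boltzmann Φ {j} (Function.update ω j x)) := by
    -- Integrating the two-point inequality over y in the arc of x replaces the Boltzmann factors at
    -- y by the partition functions.
    have hint : boltzmann Φ {j} (Function.update η j x) * partitionFn Φ σ' {j} ω ≤
        (1 + E) * boltzmann Φ {j} (Function.update ω j x) * partitionFn Φ σ' {j} η := by
      rw [hZ η, hZ ω, ← lintegral_const_mul _ (measurable_boltzmann_update hΦ j ω),
        ← lintegral_const_mul _ (measurable_boltzmann_update hΦ j η)]
      exact setLIntegral_mono' (measurableSet_arc _) fun y hy =>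
        hp x y (dist_le_of_discretize_eq (hx.trans (Eq.symm hy)))
    rw [ENNReal.inv_mul_le_iff (hZ0 η) (hZt η)]
    calc boltzmann Φ {j} (Function.update η j x)
        = boltzmann Φ {j} (Function.update η j x) * partitionFn Φ σ' {j} ω *
            (partitionFn Φ σ' {j} ω)⁻¹ := by
          rw [mul_assoc, ENNReal.mul_inv_cancel (hZ0 ω) (hZt ω), mul_one]
      _ ≤ (1 + E) * boltzmann Φ {j} (Function.update ω j x) * partitionFn Φ σ' {j} η *
            (partitionFn Φ σ' {j} ω)⁻¹ := by gcongr
      _ = _ := by ring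
  rw [lintegral_siteLaw hΦ σ' j η hf, lintegral_siteLaw hΦ σ' j ω hf,
    ← lintegral_const_mul _ (hf.fun_mul ((measurable_boltzmann_update hΦ j ω).const_mul _))]
  refine setLIntegral_mono' (measurableSet_arc _) fun x hx => ?_
  calc _ ≤ f x * ((1 + E) * ((partitionFn Φ σ' {j} ω)⁻¹ *
        boltzmann Φ {j} (Function.update ω j x))) := by
        exact mul_le_mul_right (hdens x hx) _
    _ = _ := by ring

end SingleSite

/-! ### Uniqueness and exponential decay of the influence of a constraint. -/

section Comparison

variable {d q : ℕ} [NeZero q] {Φ : Potential d}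

/-- The law at j sees the constraint only through its value at j. Where the constraints differ, any
two laws are within β_j ≥ 1. -/
theorem isEstimate_of_isConstrainedGibbs (hΦ : IsAdmissible Φ) {α : ℝ} (hα : 0 ≤ α)
    (hq : weightedModulus Φ α (2 * Real.pi / q) ≤ 1 / 2) {σ' ω' : DiscConf d q}
    {μ ν : Measure (SpinConf d)} (hμ : IsConstrainedGibbs Φ σ' μ)
    (hν : IsConstrainedGibbs Φ ω' ν) {β b : Lattice d → ℝ≥0∞}
    (hβ : ∀ j, σ' j ≠ ω' j → 1 ≤ β j)
    (hb : ∀ j, ∑' k, interdependence Φ (2 * Real.pi / q) j k * b k + β j ≤ b j) :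
    IsEstimate μ ν b := by
  have := hμ.1
  have := hν.1
  have hP := isProbabilityMeasure_siteLaw hΦ σ'
  have hP' := isProbabilityMeasure_siteLaw hΦ ω'
  refine dobrushin_comparison (ρ := siteLaw Φ σ') (ρ' := siteLaw Φ ω') (β := β)
    (isInterdependence_siteLaw hΦ σ') (c := 1 / 2) (by simp)
    (fun j => (tsum_interdependence_le hΦ hα _ j).trans hq) (fun j f hf => ?_)
    (fun j η g r hg h => ?_) (fun j f hf => ?_) (fun j f hf => ?_) hb
  · rw [siteAverage_siteLaw hΦ σ' j hf]
    exact measurable_gibbsAverage hΦ σ' {j} hf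
  · by_cases hj : σ' j = ω' j
    · rw [siteLaw_congr hj]
      exact le_self_add
    · exact (lintegral_le_lintegral_add h).trans
        (by gcongr; exact le_mul_of_one_le_left' (hβ j hj))
  · rw [siteAverage_siteLaw hΦ σ' j hf]
    exact hμ.lintegral_gibbsAverage hΦ {j} hf
  · rw [siteAverage_siteLaw hΦ ω' j hf]
    exact hν.lintegral_gibbsAverage hΦ {j} hf

theorem oscBound_indicator {Λ : Finset (Lattice d)} {B : Set (SpinConf d)}
    (hB : ∀ σ ω : SpinConf d, (∀ i ∈ Λ, σ i = ω i) → σ ∈ B → ω ∈ B) :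
    OscBound (fun k => if k ∈ Λ then 1 else 0) (B.indicator 1) := by
  intro σ ω
  by_cases hσ : σ ∈ B
  swap
  · simp [hσ]
  by_cases hω : ω ∈ B
  · simp [hσ, hω]
  have : ¬ ∀ i ∈ Λ, σ i = ω i := fun h => hω (hB σ ω h hσ)
  push Not at this
  obtain ⟨i, hi, hne⟩ := this
  rw [indicator_of_mem hσ, indicator_of_notMem hω, zero_add]
  refine le_trans ?_ (ENNReal.le_tsum i)
  simp [hi, hne]

theorem measure_le_add_of_isEstimate {μ ν : Measure (SpinConf d)} {b : Lattice d → ℝ≥0∞}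
    (h : IsEstimate μ ν b) {Λ : Finset (Lattice d)} {B : Set (SpinConf d)}
    (hBm : MeasurableSet B)
    (hB : ∀ σ ω : SpinConf d, (∀ i ∈ Λ, σ i = ω i) → σ ∈ B → ω ∈ B) :
    μ B ≤ ν B + ∑' k, b k * if k ∈ Λ then 1 else 0 := by
  have := h _ _ (measurable_one.indicator hBm) (oscBound_indicator hB) (by
    rw [tsum_eq_sum (s := Λ) fun k hk => if_neg hk]
    exact ENNReal.sum_ne_top.2 fun k hk => by simp [hk])
  rwa [lintegral_indicator_one hBm, lintegral_indicator_one hBm] at this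

theorem IsConstrainedGibbs.unique (hΦ : IsAdmissible Φ) {α : ℝ} (hα : 0 ≤ α)
    (hq : weightedModulus Φ α (2 * Real.pi / q) ≤ 1 / 2) {σ' : DiscConf d q}
    {μ ν : Measure (SpinConf d)} (hμ : IsConstrainedGibbs Φ σ' μ)
    (hν : IsConstrainedGibbs Φ σ' ν) : μ = ν := by
  have hle {μ ν : Measure (SpinConf d)} (hμ : IsConstrainedGibbs Φ σ' μ)
      (hν : IsConstrainedGibbs Φ σ' ν) {B : Set (SpinConf d)}
      (hB : B ∈ measurableCylinders fun _ : Lattice d => Sphere1) : μ B ≤ ν B := by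
    have h := isEstimate_of_isConstrainedGibbs hΦ hα hq hμ hν (β := 0) (b := 0)
      (fun j hj => absurd rfl hj) (fun j => by simp)
    obtain ⟨Λ, T, hT, rfl⟩ := (mem_measurableCylinders B).1 hB
    have := measure_le_add_of_isEstimate h (Λ := Λ) hT.cylinder fun σ ω hσω hσ => by
      rw [mem_cylinder] at hσ ⊢
      rwa [show Λ.restrict ω = Λ.restrict σ from funext fun i => (hσω i i.2).symm]
    simpa using this
  have := hμ.1
  have := hν.1
  refine ext_of_generate_finite _ generateFrom_measurableCylinders.symm
    isPiSystem_measurableCylinders (fun B hB => (hle hμ hν hB).antisymm (hle hν hμ hB)) (by simp)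

/-- The decay of the influence of a change of the constraint at `i`. -/
theorem IsConstrainedGibbs.measure_le_add (hΦ : IsAdmissible Φ) {α : ℝ} (hα : 0 ≤ α)
    (hq : weightedModulus Φ α (2 * Real.pi / q) ≤ 1 / 2) {σ' ω' : DiscConf d q} {i : Lattice d}
    (hσω : ∀ j, j ≠ i → σ' j = ω' j) {μ ν : Measure (SpinConf d)}
    (hμ : IsConstrainedGibbs Φ σ' μ) (hν : IsConstrainedGibbs Φ ω' ν)
    {Λ : Finset (Lattice d)} (hΛ : Λ.Nonempty) {B : Set (SpinConf d)} (hBm : MeasurableSet B)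
    (hB : ∀ σ ω : SpinConf d, (∀ i ∈ Λ, σ i = ω i) → σ ∈ B → ω ∈ B) :
    μ B ≤ ν B + ENNReal.ofReal (2 * Real.exp (-α * distToSet i Λ hΛ)) := by
  obtain ⟨b, hb, hbW⟩ := exists_weighted_resolvent (C := interdependence Φ (2 * Real.pi / q))
    (W := expWeight α) (c := 1 / 2) (fun k j i => expWeight_le_mul hα k j i)
    (fun j => by
      simp_rw [interdependence_comm _ _ j]
      exact (tsum_interdependence_mul_le hΦ α _ j).trans hq) i (expWeight_self α i)
  have h := isEstimate_of_isConstrainedGibbs hΦ hα hq hμ hν (b := b)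
    (β := fun j => if j = i then 1 else 0)
    (fun j hj => by rw [if_pos (by_contra fun hji => hj (hσω j hji))]) hb
  refine (measure_le_add_of_isEstimate h hBm hB).trans ?_
  gcongr
  -- For k ∈ Λ, |i-Λ| ≤ |i-k|, so the inserted factor e^{α|k-i|} e^{-α|i-Λ|} is at least 1.
  have hterm (k : Lattice d) : b k * (if k ∈ Λ then 1 else 0) ≤
      b k * expWeight α k i * ENNReal.ofReal (Real.exp (-α * distToSet i Λ hΛ)) := by
    split_ifs with hk
    swap
    · simp
    rw [mul_assoc]
    gcongr
    rw [expWeight, ← ENNReal.ofReal_mul (Real.exp_pos _).le, ← Real.exp_add,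
      ENNReal.one_le_ofReal, Real.one_le_exp_iff, latticeDist_comm]
    have : (distToSet i Λ hΛ : ℝ) ≤ latticeDist i k := by
      exact_mod_cast Finset.inf'_le (latticeDist i) hk
    nlinarith
  refine (ENNReal.tsum_le_tsum hterm).trans ?_
  rw [ENNReal.tsum_mul_right, ENNReal.ofReal_mul zero_le_two]
  gcongr
  refine hbW.trans_eq ?_
  simp

theorem isConstrainedGibbs_constrainedGibbs {σ' : DiscConf d q}
    (h : ∃! μ : Measure (SpinConf d), IsConstrainedGibbs Φ σ' μ) :
    IsConstrainedGibbs Φ σ' (constrainedGibbs Φ σ') := by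
  rw [constrainedGibbs, dif_pos h]
  exact h.choose_spec.1

end Comparison

end

end RotatorPCA

/-! ### The main theorem. -/

theorem mainTheorem9 (d : ℕ) (Φ : RotatorPCA.Potential d) (hΦ : RotatorPCA.IsAdmissible Φ)
    (α₁ : ℝ) (hα₁ : 0 < α₁) (hdecay : RotatorPCA.DecaysExponentially Φ α₁) :
    ∃ q₀ : ℕ, ∀ (q : ℕ) [NeZero q], q₀ ≤ q →
      (∀ σ' : RotatorPCA.DiscConf d q,
        ∃! μ : MeasureTheory.Measure (RotatorPCA.SpinConf d),
          RotatorPCA.IsConstrainedGibbs Φ σ' μ) ∧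
      ∃ K : ℝ, 0 < K ∧ ∀ τ : ℝ, 0 ≤ τ → τ < 2 * Real.pi →
        RotatorPCA.IsExponentiallyLocalFromPast
          (RotatorPCA.updateKernel (q := q) Φ τ) α₁ K := by
  have hlim := RotatorPCA.tendsto_weightedModulus hΦ hdecay
    (tendsto_const_div_atTop_nhds_zero_nat (2 * Real.pi))
  obtain ⟨q₀, hq₀⟩ := Filter.eventually_atTop.1
    (hlim.eventually_le_const (by simp : (0 : ℝ≥0∞) < 1 / 2))
  refine ⟨q₀, fun q _ hq => ?_⟩
  have hc := hq₀ q hq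
  have huniq (σ' : RotatorPCA.DiscConf d q) :
      ∃! μ : MeasureTheory.Measure (RotatorPCA.SpinConf d),
        RotatorPCA.IsConstrainedGibbs Φ σ' μ := by
    obtain ⟨μ, hμ⟩ := RotatorPCA.exists_isConstrainedGibbs hΦ σ'
    exact ⟨μ, hμ, fun ν hν => hν.unique hΦ hα₁.le hc hμ⟩
  -- The constant is (1 - 1/2)⁻¹ = 2. The rotation enters only through the event B, which depends on
  -- the spins in Λ alone; hence uniformity in τ.
  refine ⟨huniq, 2, two_pos, fun τ _ _ i Λ hΛ η => ?_⟩
  set B : Set (RotatorPCA.SpinConf d) :=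
    (fun σ i => RotatorPCA.discretize q (σ i + (τ : RotatorPCA.Sphere1))) ⁻¹'
      RotatorPCA.cylinderSet Λ η with hBdef
  have hcyl : MeasurableSet (RotatorPCA.cylinderSet Λ η) := by
    have : RotatorPCA.cylinderSet Λ η = ⋂ j ∈ Λ, {ξ : RotatorPCA.DiscConf d q | ξ j = η j} := by
      ext ξ
      simp [RotatorPCA.cylinderSet]
    rw [this]
    exact Finset.measurableSet_biInter Λ fun j _ =>
      (measurable_pi_apply j : Measurable fun ξ : RotatorPCA.DiscConf d q => ξ j)
        (measurableSet_singleton (η j))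
  have hBm : MeasurableSet B := RotatorPCA.measurable_rotate_project d q τ hcyl
  have hB (σ ω : RotatorPCA.SpinConf d) (h : ∀ i ∈ Λ, σ i = ω i) (hσ : σ ∈ B) : ω ∈ B := by
    intro j hj
    change RotatorPCA.discretize q (ω j + _) = η j
    rw [← h j hj]
    exact hσ j hj
  have hreal (σ' : RotatorPCA.DiscConf d q) :
      (RotatorPCA.updateKernel Φ τ σ').real (RotatorPCA.cylinderSet Λ η) =
        (RotatorPCA.constrainedGibbs Φ σ').real B :=
    map_measureReal_apply (RotatorPCA.measurable_rotate_project d q τ) hcyl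
  have hle (σ ω : RotatorPCA.DiscConf d q) (h : ∀ j, j ≠ i → σ j = ω j) :
      (RotatorPCA.constrainedGibbs Φ σ).real B ≤ (RotatorPCA.constrainedGibbs Φ ω).real B +
        2 * Real.exp (-α₁ * RotatorPCA.distToSet i Λ hΛ) := by
    have hσ := RotatorPCA.isConstrainedGibbs_constrainedGibbs (huniq σ)
    have hω := RotatorPCA.isConstrainedGibbs_constrainedGibbs (huniq ω)
    have := hω.1
    have hmain := hσ.measure_le_add hΦ hα₁.le hc h hω hΛ hBm hB
    have hpos : 0 ≤ 2 * Real.exp (-α₁ * RotatorPCA.distToSet i Λ hΛ) := by positivity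
    have h2 := ENNReal.toReal_mono
      (ENNReal.add_ne_top.2 ⟨measure_ne_top _ _, ENNReal.ofReal_ne_top⟩) hmain
    rwa [ENNReal.toReal_add (measure_ne_top _ _) ENNReal.ofReal_ne_top,
      ENNReal.toReal_ofReal hpos] at h2
  intro σ ω h
  rw [hreal, hreal, abs_le]
  have h1 := hle σ ω h
  have h2 := hle ω σ fun j hj => (h j hj).symm
  constructor <;> linarith
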